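/- **Theorem (Uniform point-wise approximation of the risk).** *Setting.* For $i=1,2,\dots$ let $\theta_i\in\mathbb R$, $b_i,h_i>0$ and $\sigma_{p,i},\sigma_{f,i}>0$; put $\tilde b_i=b_i/(b_i+h_i)$. Write $N(\mu,\sigma)$ for the normal law with mean $\mu$ and variance $\sigma$, and $\phi,\Phi$ for the standard normal density and distribution function. For each $n$ let $X=(X_1,\dots,X_n)$ have independent coordinates $X_i\sim N(\theta_i,\sigma_{p,i})$. For $\tau\in[0,\infty]$ let $\alpha_i(\tau)=\tau/(\tau+\sigma_{p,i})$ (with $\alpha_i(\infty)=1$), and let the origin-centric class $\mathcal S^0$ consist of the estimators $\hat q(\tau)$, $\tau\in[0,\infty]$, with coordinates $$\hat q_i(\tau)=\alpha_i(\tau)X_i+\sqrt{\sigma_{f,i}+\alpha_i(\tau)\sigma_{p,i}}\;\Phi^{-1}(\tilde b_i).$$ The predictive risk is $$R_n(\theta,\hat q)=\mathbb E_X\Big[\tfrac1n\sum_{i=1}^n l_i(\theta_i,\hat q_i(X))\Big],\qquad l_i(\theta_i,q)=\mathbb E_{Y\sim N(\theta_i,\sigma_{f,i})}\big[b_i(Y-q)^++h_i(q-Y)^+\big].$$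 *Assumptions.* - (A1) $0<\inf_i\tilde b_i\le\sup_i\tilde b_i<1$ and $\sup_i(b_i+h_i)<\infty$. - (A2) $\limsup_{n}\frac1n\sum_{i=1}^n|\theta_i|<\infty$. - (A3) $\sup_i\sigma_{p,i}/\sigma_{f,i}<1/(4e)$, $\sup_i\sigma_{f,i}<\infty$ and $\inf_i\sigma_{p,i}>0$. *The estimate $\widehat{\mathrm{ARE}}_n$.* Let $G(w,\beta)=\phi(w)+w\Phi(w)-\beta w$, with $G'$ its derivative in $w$, let $H_k$ be the probabilists' Hermite polynomials, and let $$c_i(\tau)=\sqrt{\frac{\sigma_{f,i}+\alpha_i(\tau)\sigma_{p,i}}{\sigma_{f,i}+\alpha_i(\tau)^2\sigma_{p,i}}}\;\Phi^{-1}(\tilde b_i),\qquad d_i(\tau)=-\frac{1-\alpha_i(\tau)}{\sqrt{\sigma_{f,i}+\sigma_{p,i}\alpha_i(\tau)^2}}.$$ Fix constants $\gamma(i)$ with $\inf_i\gamma(i)>0$ and $\gamma(i)<1/\sqrt{4e}-\sqrt{\sigma_{p,i}/\sigma_{f,i}}$ for every $i$, and set $$\lambda_n(i)=\gamma(i)\sqrt{2\log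 n},\qquad K_n(i)=1+\Big\lceil e^2\big(\gamma(i)+\sqrt{2\sigma_{p,i}/\sigma_{f,i}}\big)^2(2\log n)\Big\rceil .$$ With $s=s_i(\tau)=2\sigma_{p,i}d_i(\tau)^2$, let $$S_i(u)=G(0,\tilde b_i)+G'(0,\tilde b_i)\,u+\phi(0)\sum_{k=0}^{K_n(i)-2}\frac{(-1)^kH_k(0)}{(k+2)!}\,s^{(k+2)/2}H_{k+2}\big(u/\sqrt{s}\big),$$ where $s^{m/2}H_m(u/\sqrt s)$, a polynomial in $u$ and $s$, is read as $u^m$ when $s=0$ (i.e. $\tau=\infty$), and let $\tilde S_i(u)=\mathrm{sign}(S_i(u))\min\{|S_i(u)|,n\}$. Let $Z_i\sim N(0,1)$ be independent of each other and of $X$, let $U_i(\tau)=c_i(\tau)+d_i(\tau)(X_i+\sqrt{\sigma_{p,i}}Z_i)$ and $V_i(\tau)=c_i(\tau)+d_i(\tau)(X_i-\sqrt{\sigma_{p,i}}Z_i)$, and let $$\hat T_i(X_i,Z_i,\tau)=\begin{cases}-\tilde b_i\,U_i(\tau)&\text{if }V_i(\tau)<-\lambda_n(i),\\ \tilde S_i(U_i(\tau))&\text{if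 }-\lambda_n(i)\le V_i(\tau)\le\lambda_n(i),\\ (1-\tilde b_i)\,U_i(\tau)&\text{if }V_i(\tau)>\lambda_n(i).\end{cases}$$ Finally let $\hat T_i(X_i,\tau)=\mathbb E[\hat T_i(X_i,Z_i,\tau)\mid X]$ and $$\widehat{\mathrm{ARE}}_n(\tau)=\frac1n\sum_{i=1}^n(b_i+h_i)\sqrt{\sigma_{f,i}+\sigma_{p,i}\alpha_i(\tau)^2}\;\hat T_i(X_i,\tau).$$ *Conclusion.* Under (A1)–(A3), with $a_n=\log\log n$, $$\lim_{n\to\infty}a_n^8\,\sup_{\tau\in[0,\infty]}\mathbb E\Big[\big(\widehat{\mathrm{ARE}}_n(\tau)-R_n(\theta,\hat q(\tau))\big)^2\Big]=0,$$ the expectation being over $X$. -/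

import Mathlib

open MeasureTheory ProbabilityTheory Filter Topology
open scoped NNReal ENNReal

noncomputable section

namespace CheckLoss

/-- Standard normal density. -/
def stdPdf (w : ℝ) : ℝ := gaussianPDFReal 0 1 w

/-- Standard normal distribution function. -/
def stdCdf (w : ℝ) : ℝ := cdf (gaussianReal 0 1) w

/-- Standard normal quantile function, the inverse of `stdCdf` on `(0, 1)`. -/
def stdQuantile (p : ℝ) : ℝ := sInf {w : ℝ | p ≤ stdCdf w}

/-- `G(w, β) = φ(w) + w Φ(w) - β w`. -/
def G (w β : ℝ) : ℝ := stdPdf w + w * stdCdf w - β * w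

/-- The known data of one coordinate: under-estimation weight `b`, over-estimation weight `h`,
variance `sp` of the past observation and variance `sf` of the future observation. -/
structure Coord where
  b : ℝ
  h : ℝ
  sp : ℝ≥0
  sf : ℝ≥0
  b_pos : 0 < b
  h_pos : 0 < h
  sp_pos : 0 < sp
  sf_pos : 0 < sf

namespace Coord

variable (C : Coord)

/-- The critical ratio `b / (b + h)`. -/
def ratio : ℝ := C.b / (C.b + C.h)

/-- The predictive check loss `E_{Y ∼ N(θ, sf)} [b (Y - q)⁺ + h (q - Y)⁺]`. -/
def loss (θ q : ℝ) : ℝ :=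
  ∫ y, (C.b * max (y - q) 0 + C.h * max (q - y) 0) ∂(gaussianReal θ C.sf)

/-- The shrinkage factor `τ / (τ + sp)` for `τ ∈ [0, ∞]`, with value `1` at `τ = ∞`. -/
def shrink (τ : ℝ≥0∞) : ℝ := if τ = ∞ then 1 else τ.toReal / (τ.toReal + C.sp)

/-- The origin-centric shrinkage estimate as a function of the past observation `x`. -/
def est (τ : ℝ≥0∞) (x : ℝ) : ℝ :=
  C.shrink τ * x + √((C.sf : ℝ) + C.shrink τ * C.sp) * stdQuantile C.ratio

/-- The intercept of the affine map `θ ↦ c + d θ` in the risk `(b + h) √(sf + α² sp) G(c + d θ)`. -/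
def c (τ : ℝ≥0∞) : ℝ :=
  √(((C.sf : ℝ) + C.shrink τ * C.sp) / ((C.sf : ℝ) + C.shrink τ ^ 2 * C.sp)) *
    stdQuantile C.ratio

/-- The slope of that affine map; it vanishes at `τ = ∞`. -/
def d (τ : ℝ≥0∞) : ℝ :=
  -((1 - C.shrink τ) / √((C.sf : ℝ) + C.sp * C.shrink τ ^ 2))

end Coord

/-- Probabilists' Hermite polynomial as a real function. -/
def herm (k : ℕ) (x : ℝ) : ℝ := Polynomial.aeval x (Polynomial.hermite k)

/-- `s^{k/2} H_k(u / √s)`. This is a polynomial in `u` and `s`; its value at `s = 0` is `u ^ k`. -/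
def scaledHerm (k : ℕ) (s u : ℝ) : ℝ :=
  if s = 0 then u ^ k else √s ^ k * herm k (u / √s)

namespace Coord

variable (C : Coord)

/-- The threshold `γ √(2 log n)`. -/
def thr (γ : ℝ) (n : ℕ) : ℝ := γ * √(2 * Real.log n)

/-- The truncation order `1 + ⌈e² (γ + √(2 sp / sf))² (2 log n)⌉`. -/
def order (γ : ℝ) (n : ℕ) : ℕ :=
  1 + ⌈Real.exp 1 ^ 2 * (γ + √(2 * C.sp / C.sf)) ^ 2 * (2 * Real.log n)⌉₊

/-- The Hermite polynomial estimate `S`. -/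
def S (γ : ℝ) (n : ℕ) (τ : ℝ≥0∞) (u : ℝ) : ℝ :=
  G 0 C.ratio + deriv (fun w => G w C.ratio) 0 * u +
    stdPdf 0 * ∑ k ∈ Finset.range (C.order γ n - 1),
      (-1) ^ k * herm k 0 / ((k + 2).factorial : ℝ) *
        scaledHerm (k + 2) (2 * C.sp * C.d τ ^ 2) u

/-- `S` truncated to absolute value at most `n`. -/
def STrunc (γ : ℝ) (n : ℕ) (τ : ℝ≥0∞) (u : ℝ) : ℝ :=
  Real.sign (C.S γ n τ u) * min |C.S γ n τ u| n

/-- The randomized threshold estimate, with past observation `x` and added noise `z`. -/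
def TRand (γ : ℝ) (n : ℕ) (τ : ℝ≥0∞) (x z : ℝ) : ℝ :=
  let u := C.c τ + C.d τ * (x + √(C.sp : ℝ) * z)
  let v := C.c τ + C.d τ * (x - √(C.sp : ℝ) * z)
  if v < -thr γ n then -C.ratio * u
  else if v ≤ thr γ n then C.STrunc γ n τ u
  else (1 - C.ratio) * u

/-- The Rao-Blackwellized estimate: the noise `z ∼ N(0, 1)`, independent of the observations,
is integrated out. -/
def T (γ : ℝ) (n : ℕ) (τ : ℝ≥0∞) (x : ℝ) : ℝ :=
  ∫ z, C.TRand γ n τ x z ∂(gaussianReal 0 1)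

end Coord

/-- The law of the past data `X ∼ N(θ, diag(sp))` of the first `n` coordinates. -/
def pastLaw (M : ℕ → Coord) (θ : ℕ → ℝ) (n : ℕ) : Measure (Fin n → ℝ) :=
  Measure.pi fun i : Fin n => gaussianReal (θ i) (M i).sp

/-- The average predictive loss `L_n(θ, q)`. -/
def avgLoss (M : ℕ → Coord) (θ : ℕ → ℝ) (n : ℕ) (q : Fin n → ℝ) : ℝ :=
  (1 / n : ℝ) * ∑ i : Fin n, (M i).loss (θ i) (q i)

/-- The predictive risk `R_n(θ, q̂) = E_{X ∼ N(θ, diag(sp))} [L_n(θ, q̂(X))]`. -/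
def risk (M : ℕ → Coord) (θ : ℕ → ℝ) (n : ℕ) (q : (Fin n → ℝ) → Fin n → ℝ) : ℝ :=
  ∫ x, avgLoss M θ n (q x) ∂(pastLaw M θ n)

/-- The estimator `q̂(τ)`; the class of origin-centric estimators is its range over
`τ ∈ [0, ∞]`. -/
def originEst (M : ℕ → Coord) (n : ℕ) (τ : ℝ≥0∞) (x : Fin n → ℝ) : Fin n → ℝ :=
  fun i => (M i).est τ (x i)

/-- The asymptotic risk estimate at the data `x`. -/
def ARE (M : ℕ → Coord) (γ : ℕ → ℝ) (n : ℕ) (τ : ℝ≥0∞) (x : Fin n → ℝ) : ℝ :=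
  (1 / n : ℝ) * ∑ i : Fin n,
    ((M i).b + (M i).h) * √(((M i).sf : ℝ) + (M i).sp * (M i).shrink τ ^ 2) *
      (M i).T (γ i) n τ (x i)

/-- Bounded weights: `0 < inf b/(b+h)`, `sup b/(b+h) < 1` and `sup (b+h) < ∞`. -/
def BoundedWeights (M : ℕ → Coord) : Prop :=
  (∃ l : ℝ, 0 < l ∧ ∀ i, l ≤ (M i).ratio) ∧ (∃ r : ℝ, r < 1 ∧ ∀ i, (M i).ratio ≤ r) ∧
    ∃ B : ℝ, ∀ i, (M i).b + (M i).h ≤ B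

/-- Bounded average magnitude: `limsup (1/n) ∑ |θ_i| < ∞`. -/
def BoundedMeans (θ : ℕ → ℝ) : Prop :=
  limsup (fun n : ℕ => (((1 / n : ℝ) * ∑ i ∈ Finset.range n, |θ i| : ℝ) : EReal)) atTop < ⊤

/-- Sufficient historical data: `sup sp/sf < 1/(4e)`, `sup sf < ∞` and `inf sp > 0`. -/
def SufficientData (M : ℕ → Coord) : Prop :=
  (∃ r : ℝ, r < 1 / (4 * Real.exp 1) ∧ ∀ i, ((M i).sp / (M i).sf : ℝ) ≤ r) ∧
    (∃ B : ℝ, ∀ i, ((M i).sf : ℝ) ≤ B) ∧ ∃ l : ℝ, 0 < l ∧ ∀ i, l ≤ (M i).sp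

/-- Admissible threshold constants: bounded away from `0`, and
`γ_i < 1/√(4e) - √(sp/sf)` in each coordinate. -/
def AdmissibleThresholds (M : ℕ → Coord) (γ : ℕ → ℝ) : Prop :=
  (∃ l : ℝ, 0 < l ∧ ∀ i, l ≤ γ i) ∧
    ∀ i, γ i < 1 / √(4 * Real.exp 1) - √((M i).sp / (M i).sf : ℝ)

end CheckLoss

end

namespace CheckLoss

/-! ### Hermite polynomials under the Gaussian law -/

/-! Since `Y - q̂` is normal, the risk is the average of `(b + h) √(sf + α² sp) G(w)` with `w = c +
d θ` (`Coord.loss_comp_est`, `risk_originEst`), so the task is to estimate `G(w)` in each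
coordinate. The variables `U` and `V` are independent, both `N(w, s)` with `s = 2 sp d²`
(`map_prod_gaussianReal`); hence `V` may select the branch without biasing the value computed from
`U`.

In the outer branches the linear estimates miss `G(w)` in mean by `posMean (±w)`. Either this is
Gaussian-small, or the branch itself has Gaussian-small probability (`mul_posMean_neg_le`). In the
middle branch, rescaled Hermite polynomials are unbiased for powers of the mean, so `hermEst` is
unbiased for the Taylor polynomial of `G` at `0` (`integral_hermEst`). With order proportional to
`log n` the Taylor error is about `n^(-γ²)`, and the second moment is at most a power of `log n`
times `exp (w² / (1 - s))`.

The constants serve a balance of powers of `n`. Let `ρ = sp / sf` and call `w` near if `|w| ≤ (γ +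
5/4 √(2ρ)) √(2 log n)`. For near `w` the bounds on `ρ` and `γ` give `exp (w² / (1 - s)) ≤ n^(3/4)`,
so that clipping at `n` costs a bias of order `n^(-1/4)`. For other `w` the middle branch is chosen
with probability at most `n^(-5/4)`, which beats the clip level `n`.

Up to powers of `log n`, each coordinate thus has bias `n^(-δ)` and second moment `n^(3/4)`,
uniformly in `θ` and `τ` (`Coord.T_bounds`); integrating out the noise only lowers the second
moment. By independence the average has mean squared error at most a power of `log n` times
`n^(-1/4) + n^(-2δ)` (`lintegral_sq_average_le`), which beats any power of `log log n`. -/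

open Polynomial in
lemma integrable_eval_gaussianReal (p : ℝ[X]) (m : ℝ) (v : ℝ≥0) :
    Integrable (fun z => p.eval z) (gaussianReal m v) := by
  induction p using Polynomial.induction_on' with
  | add p q hp hq => exact (hp.add hq).congr (ae_of_all _ fun z => by simp)
  | monomial k a =>
    simp only [eval_monomial]
    refine Integrable.const_mul ?_ a
    have := (memLp_id_gaussianReal (μ := m) (v := v) (k : ℝ≥0))
    rcases eq_or_ne k 0 with rfl | hk
    · simp
    have h2 := MemLp.integrable_norm_pow (p := k) (by simpa using this) hk
    refine h2.mono (by fun_prop) (ae_of_all _ fun x => by simp)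

lemma hasDerivAt_stdPdf (x : ℝ) : HasDerivAt stdPdf (-(x * stdPdf x)) x := by
  have h : stdPdf = fun x : ℝ => (√(2 * Real.pi))⁻¹ * Real.exp (-(x ^ 2 / 2)) := by
    ext x; simp [stdPdf, gaussianPDFReal]; left; ring
  rw [h]
  have h2 : HasDerivAt (fun x : ℝ => -(x ^ 2 / 2)) (-x) x := by
    convert! ((hasDerivAt_pow 2 x).div_const 2).neg using 1; simp
  convert! (h2.exp.const_mul (√(2 * Real.pi))⁻¹) using 1
  ring

open Polynomial in
lemma integrable_stdPdf_mul_eval (p : ℝ[X]) : Integrable (fun z => stdPdf z * p.eval z) := by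
  have h := integrable_eval_gaussianReal p 0 1
  rw [gaussianReal_of_var_ne_zero 0 one_ne_zero,
    integrable_withDensity_iff_integrable_smul' (measurable_gaussianPDF 0 1)
      (ae_of_all _ fun x => gaussianPDF_lt_top)] at h
  simpa [toReal_gaussianPDF, stdPdf] using h

open Polynomial in
/-- Gaussian integration by parts for polynomials. -/
lemma integral_mul_eval_gaussianReal (p : ℝ[X]) :
    ∫ z, z * p.eval z ∂(gaussianReal 0 1) = ∫ z, (derivative p).eval z ∂(gaussianReal 0 1) := by
  rw [integral_gaussianReal_eq_integral_smul one_ne_zero,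
    integral_gaussianReal_eq_integral_smul one_ne_zero]
  have h := integral_mul_deriv_eq_deriv_mul_of_integrable (A := ℝ)
    (u := fun z => p.eval z) (v := stdPdf) (u' := fun z => (derivative p).eval z)
    (v' := fun z => -(z * stdPdf z)) (fun x _ => p.hasDerivAt x) (fun x _ => hasDerivAt_stdPdf x)
    ?_ ?_ ?_
  · have h2 : ∀ z : ℝ, gaussianPDFReal 0 1 z = stdPdf z := fun z => rfl
    simp only [smul_eq_mul, h2]
    simp only [mul_neg, integral_neg, neg_inj] at h
    simpa only [neg_inj, mul_comm, mul_left_comm, mul_assoc] using h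
  · convert! (integrable_stdPdf_mul_eval (-(X * p))) using 1
    ext z; simp; ring
  · convert! (integrable_stdPdf_mul_eval (derivative p)) using 1
    ext z; simp; ring
  · convert! (integrable_stdPdf_mul_eval p) using 1
    ext z; simp; ring

open Polynomial in
/-- The Hermite polynomial with real coefficients. -/
noncomputable def hermR (k : ℕ) : ℝ[X] := (hermite k).map (Int.castRingHom ℝ)

lemma herm_eq (k : ℕ) (x : ℝ) : herm k x = (hermR k).eval x := by
  simp [herm, hermR, Polynomial.aeval_def, Polynomial.eval_map]

open Polynomial in
lemma hermR_succ (k : ℕ) : hermR (k + 1) = X * hermR k - derivative (hermR k) := by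
  simp [hermR, hermite_succ]

open Polynomial in
lemma hermR_zero : hermR 0 = 1 := by simp [hermR]

open Polynomial in
lemma derivative_hermR_succ (k : ℕ) :
    derivative (hermR (k + 1)) = ((k : ℝ[X]) + 1) * hermR k := by
  induction k with
  | zero => simp [hermR_succ, hermR_zero]
  | succ k ih =>
    rw [hermR_succ (k + 1), derivative_sub, derivative_mul, ih, hermR_succ k]
    simp only [derivative_X, derivative_mul, derivative_add, derivative_natCast, derivative_one]
    push_cast
    ring

open Polynomial in
-- Each step `X H_k - H_k'` of the recursion is one Gaussian integration by parts. The choices `p =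
-- 1` and `p = H_k` give mean zero and `E H_k² = k!`.
lemma integral_hermR_mul (k : ℕ) (p : ℝ[X]) :
    ∫ z, (hermR k).eval z * p.eval z ∂(gaussianReal 0 1) =
      ∫ z, (derivative^[k] p).eval z ∂(gaussianReal 0 1) := by
  induction k generalizing p with
  | zero => simp [hermR_zero]
  | succ k ih =>
    have h := integral_mul_eval_gaussianReal (hermR k * p)
    rw [derivative_mul] at h
    simp only [eval_add, eval_mul] at h
    rw [integral_add ((integrable_eval_gaussianReal (derivative (hermR k) * p) 0 1).congr
        (ae_of_all _ fun z => by simp))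
      ((integrable_eval_gaussianReal (hermR k * derivative p) 0 1).congr
        (ae_of_all _ fun z => by simp))] at h
    rw [Function.iterate_succ_apply, ← ih (derivative p), hermR_succ]
    simp only [eval_sub, eval_mul, eval_X, sub_mul]
    rw [integral_sub ((integrable_eval_gaussianReal (X * hermR k * p) 0 1).congr
        (ae_of_all _ fun z => by simp))
      ((integrable_eval_gaussianReal (derivative (hermR k) * p) 0 1).congr
        (ae_of_all _ fun z => by simp))]
    simp only [mul_assoc] at h ⊢
    rw [h]; ring

lemma integral_herm_succ (k : ℕ) : ∫ z, herm (k + 1) z ∂(gaussianReal 0 1) = 0 := by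
  have h := integral_hermR_mul (k + 1) 1
  simpa [herm_eq, Function.iterate_succ_apply] using h

open Polynomial in
lemma iterate_derivative_hermR (k : ℕ) : derivative^[k] (hermR k) = (k.factorial : ℝ[X]) := by
  induction k with
  | zero => simp [hermR_zero]
  | succ k ih =>
    rw [Function.iterate_succ_apply, derivative_hermR_succ,
      show ((k : ℝ[X]) + 1) = ((k + 1 : ℕ) : ℝ[X]) by push_cast; rfl,
      iterate_derivative_natCast_mul, ih, Nat.factorial_succ]
    push_cast; ring

lemma integral_herm_sq (k : ℕ) : ∫ z, herm k z ^ 2 ∂(gaussianReal 0 1) = k.factorial := by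
  have h := integral_hermR_mul k (hermR k)
  simpa [herm_eq, sq, iterate_derivative_hermR] using h

open Polynomial in
-- The Appell property `H_{k+1}' = (k + 1) H_k`, iterated. It supplies the Taylor coefficients of
-- `H_m(z + a)` in `herm_add`.
lemma hasseDeriv_hermR (m k : ℕ) :
    hasseDeriv k (hermR (k + m)) = (((k + m).choose k : ℕ) : ℝ[X]) * hermR m := by
  induction k with
  | zero => simp
  | succ k ih =>
    have h2 := congrArg (fun f => f (hermR (k + 1 + m))) (hasseDeriv_comp (R := ℝ) k 1)
    simp only [LinearMap.comp_apply, LinearMap.smul_apply, hasseDeriv_one] at h2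
    rw [show k + 1 + m = k + m + 1 by ring, derivative_hermR_succ] at h2
    rw [show ((k + m : ℕ) : ℝ[X]) + 1 = C ((k : ℝ) + m + 1) by simp, ← smul_eq_C_mul, map_smul, ih,
      Nat.choose_succ_self_right] at h2
    rw [show k + 1 + m = k + m + 1 by ring]
    have h3 : (C ((k : ℝ) + 1)) * hasseDeriv (k + 1) (hermR (k + m + 1)) =
        (C ((k : ℝ) + 1)) * ((((k + m + 1).choose (k + 1) : ℕ) : ℝ[X]) * hermR m) := by
      have h4 : ((k : ℝ) + m + 1) * ((k + m).choose k : ℕ)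
          = ((k + m + 1).choose (k + 1) : ℕ) * ((k : ℝ) + 1) := by
        exact_mod_cast Nat.add_one_mul_choose_eq (k + m) k
      calc _ = (k + 1) • hasseDeriv (k + 1) (hermR (k + m + 1)) := by
            simp [nsmul_eq_mul]
        _ = C (((k : ℝ) + m + 1) * ((k + m).choose k : ℕ)) * hermR m := by
            rw [← h2, smul_eq_C_mul, C_mul, C_eq_natCast, mul_assoc]
        _ = _ := by rw [h4]; simp; ring
    exact mul_left_cancel₀ (by rw [Ne, C_eq_zero]; positivity) h3

open Polynomial in
lemma herm_add (m : ℕ) (z a : ℝ) :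
    herm m (z + a) = ∑ k ∈ Finset.range (m + 1), (m.choose k : ℝ) * herm (m - k) z * a ^ k := by
  have hdeg : (taylor z (hermR m)).natDegree < m + 1 := by
    rw [natDegree_taylor, hermR]
    exact Nat.lt_succ_of_le (natDegree_map_le.trans natDegree_hermite.le)
  rw [herm_eq, add_comm, ← taylor_eval, eval_eq_sum_range' hdeg]
  refine Finset.sum_congr rfl fun k hk => ?_
  rw [taylor_coeff]
  obtain ⟨j, rfl⟩ := Nat.exists_eq_add_of_le (Nat.lt_succ_iff.1 (Finset.mem_range.1 hk))
  rw [hasseDeriv_hermR]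
  simp [herm_eq]

lemma herm_zero (x : ℝ) : herm 0 x = 1 := by simp [herm]

/-- Separates mean from noise: every term but `k = m` carries a Hermite factor of positive degree,
which integrates to zero, and the term `k = m` is `w ^ m`. At `s = 0` the other terms vanish because
of the power of `√0`. -/
lemma scaledHerm_affine (m : ℕ) {s : ℝ} (hs : 0 ≤ s) (w z : ℝ) :
    scaledHerm m s (w + √s * z) =
      ∑ k ∈ Finset.range (m + 1), (m.choose k : ℝ) * w ^ k * √s ^ (m - k) * herm (m - k) z := by
  rcases hs.eq_or_lt with rfl | hs
  · rw [Finset.sum_range_succ, Finset.sum_eq_zero]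
    · simp [scaledHerm, herm_zero]
    · intro k hk
      simp [Nat.sub_ne_zero_of_lt (Finset.mem_range.1 hk)]
  · have h0 : √s ≠ 0 := (Real.sqrt_pos.2 hs).ne'
    rw [scaledHerm, if_neg hs.ne', show (w + √s * z) / √s = z + w / √s by field_simp; ring,
      herm_add,
      Finset.mul_sum]
    refine Finset.sum_congr rfl fun k hk => ?_
    obtain ⟨j, rfl⟩ := Nat.exists_eq_add_of_le (Nat.lt_succ_iff.1 (Finset.mem_range.1 hk))
    rw [Nat.add_sub_cancel_left, div_pow, pow_add]
    field_simp

lemma integrable_herm (k : ℕ) : Integrable (herm k) (gaussianReal 0 1) := by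
  simpa [← herm_eq] using integrable_eval_gaussianReal (hermR k) 0 1

lemma integrable_herm_sq (k : ℕ) : Integrable (fun z => herm k z ^ 2) (gaussianReal 0 1) := by
  exact (integrable_eval_gaussianReal (hermR k ^ 2) 0 1).congr
    (ae_of_all _ fun z => by simp [herm_eq])

lemma integral_gaussianReal_eq_std {s : ℝ} (hs : 0 ≤ s) (w : ℝ) (f : ℝ → ℝ) (hf : Measurable f) :
    ∫ u, f u ∂(gaussianReal w s.toNNReal) = ∫ z, f (w + √s * z) ∂(gaussianReal 0 1) := by
  rw [← integral_map (φ := fun z => w + √s * z) (by fun_prop) hf.aestronglyMeasurable]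
  congr 1
  rw [show (fun z => w + √s * z) = (fun z => w + z) ∘ fun z => √s * z from rfl,
    ← Measure.map_map (by fun_prop) (by fun_prop), gaussianReal_map_const_mul,
    gaussianReal_map_const_add]
  congr 1
  · simp
  · ext; simp [Real.sq_sqrt hs, hs]

/-! ### Moments of the Hermite estimate -/

open Polynomial in
-- Measurability and integrability of all the Hermite estimates below come from their being
-- polynomials in `u` for fixed `s`.
lemma exists_scaledHerm_eq_eval (m : ℕ) (s : ℝ) :
    ∃ q : ℝ[X], ∀ u, scaledHerm m s u = q.eval u := by
  by_cases hs : s = 0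
  · exact ⟨X ^ m, fun u => by simp [scaledHerm, hs]⟩
  · refine ⟨C (√s ^ m) * (hermR m).comp (C (√s)⁻¹ * X), fun u => ?_⟩
    simp [scaledHerm, hs, herm_eq, div_eq_inv_mul]

lemma integral_scaledHerm (m : ℕ) {s : ℝ} (hs : 0 ≤ s) (w : ℝ) :
    ∫ u, scaledHerm m s u ∂(gaussianReal w s.toNNReal) = w ^ m := by
  obtain ⟨q, hq⟩ := exists_scaledHerm_eq_eval m s
  rw [integral_gaussianReal_eq_std hs _ _ (by rw [funext hq]; fun_prop)]
  simp only [scaledHerm_affine m hs]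
  rw [integral_finsetSum _ fun k _ => (integrable_herm _).const_mul _, Finset.sum_range_succ,
    Finset.sum_eq_zero]
  · simp [herm_zero]
  · intro k hk
    obtain ⟨j, hj⟩ := Nat.exists_eq_succ_of_ne_zero
      (Nat.sub_ne_zero_of_lt (Finset.mem_range.1 hk))
    rw [integral_const_mul, hj, integral_herm_succ, mul_zero]

lemma integral_scaledHerm_sq_le (m : ℕ) {s : ℝ} (hs : 0 ≤ s) (hs1 : s < 1) (w : ℝ) :
    ∫ u, scaledHerm m s u ^ 2 ∂(gaussianReal w s.toNNReal) ≤
      (m + 1) * (m.factorial * Real.exp (w ^ 2 / (1 - s))) := by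
  obtain ⟨q, hq⟩ := exists_scaledHerm_eq_eval m s
  rw [integral_gaussianReal_eq_std hs _ _ (by rw [funext hq]; fun_prop)]
  have hI : Integrable (fun z => (m + 1 : ℝ) * ∑ k ∈ Finset.range (m + 1),
      ((m.choose k : ℝ) * w ^ k * √s ^ (m - k)) ^ 2 * herm (m - k) z ^ 2) (gaussianReal 0 1) :=
    (integrable_finsetSum _ fun k _ => (integrable_herm_sq _).const_mul _).const_mul _
  calc _ ≤ ∫ z, (m + 1 : ℝ) * ∑ k ∈ Finset.range (m + 1),
      ((m.choose k : ℝ) * w ^ k * √s ^ (m - k)) ^ 2 * herm (m - k) z ^ 2 ∂(gaussianReal 0 1) := by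
        refine integral_mono_of_nonneg (ae_of_all _ fun z => sq_nonneg _) hI
          (ae_of_all _ fun z => ?_)
        simp only [scaledHerm_affine m hs]
        -- Cauchy–Schwarz in place of orthogonality costs only the factor `m + 1`.
        refine sq_sum_le_card_mul_sum_sq.trans_eq ?_
        simp [mul_pow]
    _ = (m + 1 : ℝ) * ∑ k ∈ Finset.range (m + 1),
      ((m.choose k : ℝ) * w ^ k * √s ^ (m - k)) ^ 2 * (m - k).factorial := by
        rw [integral_const_mul, integral_finsetSum _ fun k _ => (integrable_herm_sq _).const_mul _]
        simp only [integral_const_mul, integral_herm_sq]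
    _ ≤ (m + 1 : ℝ) * ∑ k ∈ Finset.range (m + 1), (m.factorial * Real.exp (w ^ 2 / (1 - s))) *
          ((1 - s) ^ k * s ^ (m - k) * m.choose k) := by
        refine mul_le_mul_of_nonneg_left (Finset.sum_le_sum fun k hk => ?_) (by positivity)
        obtain ⟨j, rfl⟩ := Nat.exists_eq_add_of_le (Nat.lt_succ_iff.1 (Finset.mem_range.1 hk))
        rw [Nat.add_sub_cancel_left]
        have h1 : 0 < 1 - s := by linarith
        -- The argument `w² / (1 - s)` makes the remaining weights `C(m,k) (1 - s)^k s^(m-k)`, whose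
        -- sum is `((1 - s) + s)^m = 1`.
        have h2 := Real.pow_div_factorial_le_exp (w ^ 2 / (1 - s)) (by positivity) k
        rw [div_pow, div_div, div_le_iff₀ (by positivity)] at h2
        have h3 : ((k + j).factorial : ℝ) = (k + j).choose k * k.factorial * j.factorial := by
          rw [← Nat.add_choose_mul_factorial_mul_factorial k j, Nat.choose_symm_add]
          push_cast; ring
        rw [h3]
        calc _ = (((k + j).choose k : ℝ) ^ 2 * s ^ j * j.factorial) * (w ^ 2) ^ k := by
              rw [mul_pow, mul_pow, ← pow_mul (√s), mul_comm j 2, pow_mul (√s), Real.sq_sqrt hs]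
              ring
          _ ≤ (((k + j).choose k : ℝ) ^ 2 * s ^ j * j.factorial) *
              (Real.exp (w ^ 2 / (1 - s)) * ((1 - s) ^ k * k.factorial)) := by gcongr
          _ = _ := by ring
    _ = _ := by
        rw [← Finset.mul_sum, ← add_pow]; simp

/-- The Hermite estimate with `N` terms of the sum. -/
noncomputable def hermEst (β s : ℝ) (N : ℕ) (u : ℝ) : ℝ :=
  G 0 β + deriv (fun w => G w β) 0 * u +
    stdPdf 0 * ∑ k ∈ Finset.range N,
      (-1) ^ k * herm k 0 / ((k + 2).factorial : ℝ) * scaledHerm (k + 2) s u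

/-- The Taylor polynomial of `G` at `0`. -/
noncomputable def taylorG (β : ℝ) (N : ℕ) (w : ℝ) : ℝ :=
  G 0 β + deriv (fun w => G w β) 0 * w +
    stdPdf 0 * ∑ k ∈ Finset.range N,
      (-1) ^ k * herm k 0 / ((k + 2).factorial : ℝ) * w ^ (k + 2)

open Polynomial in
lemma exists_hermEst_eq_eval (β s : ℝ) (N : ℕ) :
    ∃ q : ℝ[X], ∀ u, hermEst β s N u = q.eval u := by
  choose q hq using fun m => exists_scaledHerm_eq_eval m s
  refine ⟨C (G 0 β) + C (deriv (fun w => G w β) 0) * X +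
    C (stdPdf 0) * ∑ k ∈ Finset.range N,
      C ((-1) ^ k * herm k 0 / ((k + 2).factorial : ℝ)) * q (k + 2), fun u => ?_⟩
  simp only [hermEst, hq, eval_add, eval_mul, eval_C, eval_X, eval_finsetSum]

lemma continuous_hermEst (β s : ℝ) (N : ℕ) : Continuous (hermEst β s N) := by
  obtain ⟨q, hq⟩ := exists_hermEst_eq_eval β s N
  simpa only [funext hq] using q.continuous

lemma integrable_scaledHerm (m : ℕ) (s w : ℝ) (v : ℝ≥0) :
    Integrable (scaledHerm m s) (gaussianReal w v) := by
  obtain ⟨q, hq⟩ := exists_scaledHerm_eq_eval m s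
  simpa only [funext hq] using integrable_eval_gaussianReal q w v

lemma integrable_scaledHerm_sq (m : ℕ) (s w : ℝ) (v : ℝ≥0) :
    Integrable (fun u => scaledHerm m s u ^ 2) (gaussianReal w v) := by
  obtain ⟨q, hq⟩ := exists_scaledHerm_eq_eval m s
  exact (integrable_eval_gaussianReal (q ^ 2) w v).congr (ae_of_all _ fun z => by simp [hq])

lemma integrable_hermEst_sq (β s : ℝ) (N : ℕ) (w : ℝ) (v : ℝ≥0) :
    Integrable (fun u => hermEst β s N u ^ 2) (gaussianReal w v) := by
  obtain ⟨q, hq⟩ := exists_hermEst_eq_eval β s N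
  exact (integrable_eval_gaussianReal (q ^ 2) w v).congr (ae_of_all _ fun z => by simp [hq])

lemma integrable_hermEst (β s : ℝ) (N : ℕ) (w : ℝ) (v : ℝ≥0) :
    Integrable (hermEst β s N) (gaussianReal w v) := by
  obtain ⟨q, hq⟩ := exists_hermEst_eq_eval β s N
  simpa only [funext hq] using integrable_eval_gaussianReal q w v

lemma integrable_id_gaussianReal (w : ℝ) (v : ℝ≥0) :
    Integrable (fun u : ℝ => u) (gaussianReal w v) := by
  simpa using integrable_eval_gaussianReal Polynomial.X w v

lemma integral_hermEst (β : ℝ) {s : ℝ} (hs : 0 ≤ s) (N : ℕ) (w : ℝ) :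
    ∫ u, hermEst β s N u ∂(gaussianReal w s.toNNReal) = taylorG β N w := by
  have h1 := integrable_id_gaussianReal w s.toNNReal
  have h2 : ∀ k ∈ Finset.range N, Integrable (fun u => (-1) ^ k * herm k 0 /
      ((k + 2).factorial : ℝ) * scaledHerm (k + 2) s u) (gaussianReal w s.toNNReal) :=
    fun k _ => (integrable_scaledHerm _ _ _ _).const_mul _
  simp only [hermEst]
  have h3 : Integrable (fun u => G 0 β + deriv (fun w => G w β) 0 * u)
      (gaussianReal w s.toNNReal) := (integrable_const _).add (h1.const_mul _)
  rw [integral_add h3 ((integrable_finsetSum _ h2).const_mul _),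
    integral_add (integrable_const _) (h1.const_mul _), integral_const_mul, integral_const_mul,
    integral_finsetSum _ h2]
  simp only [integral_const_mul, integral_scaledHerm _ hs]
  simp [taylorG]

/-! ### The function `G` -/

lemma stdPdf_eq (x : ℝ) : stdPdf x = stdPdf 0 * Real.exp (-(x ^ 2 / 2)) := by
  simp [stdPdf, gaussianPDFReal]; left; ring

lemma stdPdf_nonneg (x : ℝ) : 0 ≤ stdPdf x := gaussianPDFReal_nonneg _ _ _

lemma stdPdf_zero_sq_le : stdPdf 0 ^ 2 ≤ 1 / 6 := by
  have h : stdPdf 0 ^ 2 = 1 / (2 * Real.pi) := by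
    simp [stdPdf, gaussianPDFReal, mul_pow, Real.sq_sqrt Real.pi_pos.le, mul_comm]
  rw [h]
  exact one_div_le_one_div_of_le (by norm_num) (by linarith [Real.pi_gt_three])

lemma stdPdf_zero_le_one : stdPdf 0 ≤ 1 := by
  nlinarith [stdPdf_zero_sq_le, stdPdf_nonneg 0]

lemma stdPdf_le_exp (x : ℝ) : stdPdf x ≤ Real.exp (-(x ^ 2 / 2)) := by
  rw [stdPdf_eq]
  exact mul_le_of_le_one_left (Real.exp_pos _).le stdPdf_zero_le_one

lemma stdPdf_neg (x : ℝ) : stdPdf (-x) = stdPdf x := by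
  rw [stdPdf_eq, stdPdf_eq x]; simp

lemma continuous_stdPdf : Continuous stdPdf :=
  continuous_iff_continuousAt.2 fun x => (hasDerivAt_stdPdf x).continuousAt

lemma integrable_stdPdf : Integrable stdPdf := integrable_gaussianPDFReal 0 1

lemma real_gaussianReal_eq_integral_stdPdf (s : Set ℝ) :
    (gaussianReal 0 1).real s = ∫ x in s, stdPdf x := by
  rw [measureReal_def, gaussianReal_apply_eq_integral 0 one_ne_zero, ENNReal.toReal_ofReal
    (integral_nonneg fun x => gaussianPDFReal_nonneg _ _ _)]
  rfl

lemma stdCdf_eq_integral (x : ℝ) : stdCdf x = ∫ t in Set.Iic x, stdPdf t := by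
  rw [stdCdf, cdf_eq_real, real_gaussianReal_eq_integral_stdPdf]

lemma hasDerivAt_stdCdf (x : ℝ) : HasDerivAt stdCdf (stdPdf x) x := by
  have h : stdCdf = fun x => stdCdf 0 + ∫ t in (0 : ℝ)..x, stdPdf t := by
    ext x
    rw [← intervalIntegral.integral_Iic_sub_Iic integrable_stdPdf.integrableOn
      integrable_stdPdf.integrableOn, ← stdCdf_eq_integral, ← stdCdf_eq_integral]
    ring
  rw [h]
  exact (intervalIntegral.integral_hasDerivAt_right integrable_stdPdf.intervalIntegrable
    (continuous_stdPdf.stronglyMeasurableAtFilter _ _) continuous_stdPdf.continuousAt).const_add _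

lemma stdCdf_neg (x : ℝ) : stdCdf (-x) = (gaussianReal 0 1).real (Set.Ioi x) := by
  have : NullSingletonClass (gaussianReal 0 1) := nullSingletonClass_gaussianReal one_ne_zero
  have h : (gaussianReal 0 1).map (fun x => -x) = gaussianReal 0 1 := by
    rw [gaussianReal_map_neg, neg_zero]
  rw [stdCdf, cdf_eq_real, ← h, map_measureReal_apply measurable_neg measurableSet_Iic, h]
  simp only [Set.neg_preimage, Set.neg_Iic, neg_neg]
  exact measureReal_congr Ioi_ae_eq_Ici.symm

lemma stdCdf_add_stdCdf_neg (x : ℝ) : stdCdf x + stdCdf (-x) = 1 := by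
  rw [stdCdf_neg, stdCdf, cdf_eq_real, ← Set.compl_Iic, probReal_compl_eq_one_sub measurableSet_Iic]
  ring

lemma stdCdf_nonneg (x : ℝ) : 0 ≤ stdCdf x := cdf_nonneg _ _

lemma stdCdf_le_one (x : ℝ) : stdCdf x ≤ 1 := cdf_le_one _ _

/-- The expected positive part of `w + Z` for a standard normal `Z`. -/
noncomputable def posMean (w : ℝ) : ℝ := stdPdf w + w * stdCdf w

lemma posMean_sub_posMean_neg (w : ℝ) : posMean w - posMean (-w) = w := by
  have h := stdCdf_add_stdCdf_neg w
  rw [posMean, posMean, stdPdf_neg]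
  linear_combination w * h

lemma integrable_mul_stdPdf : Integrable fun x => x * stdPdf x := by
  convert! integrable_stdPdf_mul_eval Polynomial.X using 1
  ext x; simp [mul_comm]

lemma integral_Ioi_mul_stdPdf (a : ℝ) : ∫ x in Set.Ioi a, x * stdPdf x = stdPdf a := by
  have h1 : ∀ x, HasDerivAt (fun x => -stdPdf x) (x * stdPdf x) x := fun x => by
    convert! (hasDerivAt_stdPdf x).neg using 1; simp
  have h2 : Tendsto (fun x => -stdPdf x) atTop (𝓝 (-0)) := by
    refine Tendsto.neg (squeeze_zero' (Eventually.of_forall stdPdf_nonneg)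
      (g := fun x : ℝ => Real.exp (-x)) ?_ Real.tendsto_exp_neg_atTop_nhds_zero)
    filter_upwards [eventually_ge_atTop 2] with x hx
    refine (stdPdf_le_exp x).trans (Real.exp_le_exp.2 ?_)
    nlinarith
  rw [integral_Ioi_of_hasDerivAt_of_tendsto (h1 a).continuousAt.continuousWithinAt
    (fun x _ => h1 x) integrable_mul_stdPdf.integrableOn h2]
  ring

lemma integral_max_add_gaussianReal (w : ℝ) :
    ∫ z, max (w + z) 0 ∂(gaussianReal 0 1) = posMean w := by
  rw [integral_gaussianReal_eq_integral_smul one_ne_zero]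
  calc _ = ∫ z in Set.Ioi (-w), (w * stdPdf z + z * stdPdf z) := by
        rw [← integral_indicator measurableSet_Ioi]
        congr 1; ext z
        by_cases hz : -w < z
        · rw [Set.indicator_of_mem (Set.mem_Ioi.2 hz), max_eq_left (by linarith)]
          simp only [smul_eq_mul, stdPdf]; ring
        · rw [Set.indicator_of_notMem (by simpa using hz), max_eq_right (by linarith), smul_zero]
    _ = w * stdCdf w + stdPdf w := by
        rw [integral_add (integrable_stdPdf.const_mul w).integrableOn
          integrable_mul_stdPdf.integrableOn, integral_Ioi_mul_stdPdf, integral_const_mul,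
          ← real_gaussianReal_eq_integral_stdPdf, ← stdCdf_neg, neg_neg, stdPdf_neg]
    _ = _ := by rw [posMean]; ring

lemma posMean_nonneg (w : ℝ) : 0 ≤ posMean w := by
  rw [← integral_max_add_gaussianReal]
  exact integral_nonneg fun z => le_max_right _ _

lemma posMean_le_one_add_abs (w : ℝ) : posMean w ≤ 1 + |w| := by
  have h1 : stdPdf w ≤ 1 := (stdPdf_le_exp w).trans (Real.exp_le_one_iff.2 (by nlinarith))
  have h2 : w * stdCdf w ≤ |w| :=
    calc _ ≤ |w * stdCdf w| := le_abs_self _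
      _ = |w| * stdCdf w := by rw [abs_mul, abs_of_nonneg (stdCdf_nonneg w)]
      _ ≤ |w| := mul_le_of_le_one_right (abs_nonneg _) (stdCdf_le_one w)
  rw [posMean]; linarith

lemma posMean_neg_le_exp {w : ℝ} (hw : 0 ≤ w) : posMean (-w) ≤ Real.exp (-(w ^ 2 / 2)) := by
  refine le_trans ?_ (stdPdf_le_exp w)
  rw [posMean, stdPdf_neg]
  nlinarith [stdCdf_nonneg (-w)]

/-- Exhibits both asymptotes: together with `posMean_sub_posMean_neg` it shows that `G` exceeds `-β
w` by `posMean w` and `(1 - β) w` by `posMean (-w)`. -/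
lemma G_eq (w β : ℝ) : G w β = (1 - β) * posMean w + β * posMean (-w) := by
  have h := posMean_sub_posMean_neg w
  have h2 : G w β = posMean w - β * w := rfl
  rw [h2]
  linear_combination β * h

lemma abs_G_le {β : ℝ} (h0 : 0 ≤ β) (h1 : β ≤ 1) (w : ℝ) : |G w β| ≤ 1 + |w| := by
  have h2 := posMean_le_one_add_abs w
  have h3 := posMean_le_one_add_abs (-w)
  rw [abs_neg] at h3
  have h4 := posMean_nonneg w
  have h5 := posMean_nonneg (-w)
  rw [G_eq, abs_of_nonneg (by have : 0 ≤ 1 - β := by linarith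
                              positivity)]
  nlinarith

lemma hasDerivAt_G (w β : ℝ) : HasDerivAt (fun w => G w β) (stdCdf w - β) w := by
  have h := ((hasDerivAt_stdPdf w).add ((hasDerivAt_id w).mul (hasDerivAt_stdCdf w))).sub
    ((hasDerivAt_id w).const_mul β)
  convert! h using 1
  simp

lemma integrable_max_affine (m r s : ℝ) :
    Integrable (fun z => max (m + r * z) 0) (gaussianReal 0 s.toNNReal) :=
  ((integrable_const m).add ((integrable_id_gaussianReal _ _).const_mul r)).pos_part

/-- The expected check loss of a normal variable. -/
lemma integral_check_gaussianReal (b h m : ℝ) {s : ℝ} (hs : 0 < s) :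
    ∫ t, (b * max t 0 + h * max (-t) 0) ∂(gaussianReal m s.toNNReal) =
      √s * (b * posMean (m / √s) + h * posMean (-(m / √s))) := by
  have hs' : 0 < √s := Real.sqrt_pos.2 hs
  have h1 : Integrable (fun z => max (m + √s * z) 0) (gaussianReal 0 1) := by
    simpa using integrable_max_affine m (√s) 1
  have h2 : Integrable (fun z => m + √s * z) (gaussianReal 0 1) :=
    (integrable_const m).add ((integrable_id_gaussianReal 0 1).const_mul _)
  have h3 : ∫ z, max (m + √s * z) 0 ∂(gaussianReal 0 1) = √s * posMean (m / √s) := by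
    rw [← integral_max_add_gaussianReal, ← integral_const_mul]
    congr 1; ext z
    rw [mul_max_of_nonneg _ _ hs'.le]
    congr 1
    · field_simp
    · simp
  have h4 : ∫ z, (m + √s * z) ∂(gaussianReal 0 1) = m := by
    rw [integral_add (integrable_const _) ((integrable_id_gaussianReal 0 1).const_mul _),
      integral_const_mul, integral_id_gaussianReal]
    simp
  rw [integral_gaussianReal_eq_std hs.le _ _ (by fun_prop)]
  have h5 : ∀ t : ℝ, max (-t) 0 = max t 0 - t := fun t => by
    rcases le_total t 0 with ht | ht
    · rw [max_eq_left (by linarith), max_eq_right ht]; ring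
    · rw [max_eq_right (by linarith), max_eq_left ht]; ring
  have h8 : Integrable (fun z => max (m + √s * z) 0 - (m + √s * z)) (gaussianReal 0 1) := h1.sub h2
  simp only [h5]
  rw [integral_add (h1.const_mul _) (h8.const_mul _), integral_const_mul,
    integral_const_mul, integral_sub h1 h2, h3, h4]
  have h6 := posMean_sub_posMean_neg (m / √s)
  have h7 : √s * (m / √s) = m := by field_simp
  linear_combination (h * √s) * h6 + h * h7

/-! ### Taylor expansion of `G` and second moment of the Hermite estimate -/

/-- The derivative of each remainder is minus the previous one. By induction `x^(J+1)/(J+1)!` plus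
or minus the remainder is therefore nondecreasing on `[0, ∞)`, and it vanishes at `0`. -/
lemma abs_exp_neg_sub_sum_le (J : ℕ) {x : ℝ} (hx : 0 ≤ x) :
    |Real.exp (-x) - ∑ j ∈ Finset.range J, (-x) ^ j / (j.factorial : ℝ)| ≤
      x ^ J / (J.factorial : ℝ) := by
  induction J generalizing x with
  | zero => simpa using hx
  | succ J ih =>
    have hd : ∀ x : ℝ, HasDerivAt (fun x => x ^ (J + 1) / ((J + 1).factorial : ℝ))
        (x ^ J / (J.factorial : ℝ)) x := fun x => by
      convert! (hasDerivAt_pow (J + 1) x).div_const _ using 1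
      rw [Nat.factorial_succ]; push_cast; field_simp
    have hr : ∀ x : ℝ, HasDerivAt
        (fun x => Real.exp (-x) - ∑ j ∈ Finset.range (J + 1), (-x) ^ j / (j.factorial : ℝ))
        (-(Real.exp (-x) - ∑ j ∈ Finset.range J, (-x) ^ j / (j.factorial : ℝ))) x := fun x => by
      have h1 : HasDerivAt (fun x => Real.exp (-x)) (-Real.exp (-x)) x := by
        simpa using (hasDerivAt_neg x).exp
      have h2 : HasDerivAt (fun x => ∑ j ∈ Finset.range J, (-x) ^ (j + 1) / ((j + 1).factorial : ℝ))
          (∑ j ∈ Finset.range J, -((-x) ^ j / (j.factorial : ℝ))) x := by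
        refine HasDerivAt.fun_sum fun j _ => ?_
        convert! (((hasDerivAt_neg x).fun_pow (j + 1)).div_const ((j + 1).factorial : ℝ)) using 1
        rw [Nat.factorial_succ]; push_cast; field_simp
      convert! h1.sub (h2.add_const 1) using 1
      · ext x; simp [Finset.sum_range_succ']
      · rw [Finset.sum_neg_distrib]; ring
    have key : ∀ c : ℝ, |c| ≤ 1 → 0 ≤ x ^ (J + 1) / ((J + 1).factorial : ℝ) +
        c * (Real.exp (-x) - ∑ j ∈ Finset.range (J + 1), (-x) ^ j / (j.factorial : ℝ)) := by
      intro c hc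
      have hD := fun x => (hd x).add ((hr x).const_mul c)
      have hm : MonotoneOn _ (Set.Ici (0 : ℝ)) := monotoneOn_of_hasDerivWithinAt_nonneg
        (convex_Ici 0) (fun x _ => (hD x).continuousAt.continuousWithinAt)
        (fun x _ => (hD x).hasDerivWithinAt) (fun y hy => by
          rw [interior_Ici] at hy
          have h1 := ih (le_of_lt (Set.mem_Ioi.1 hy))
          set r := Real.exp (-y) - ∑ j ∈ Finset.range J, (-y) ^ j / (j.factorial : ℝ)
          have h2 : |c * r| ≤ |r| := by
            rw [abs_mul]; exact mul_le_of_le_one_left (abs_nonneg _) hc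
          have h3 := le_abs_self (c * r)
          linarith)
      have h := hm (Set.self_mem_Ici) (Set.mem_Ici.2 hx) hx
      simpa [Finset.sum_range_succ'] using h
    have k1 := key 1 (by simp)
    have k2 := key (-1) (by simp)
    rw [abs_le]
    constructor <;> linarith

lemma herm_zero_odd (j : ℕ) : herm (2 * j + 1) 0 = 0 := by
  rw [herm, ← Polynomial.coeff_zero_eq_aeval_zero',
    Polynomial.coeff_hermite_of_odd_add (by simp), map_zero]

lemma herm_zero_even (j : ℕ) :
    herm (2 * j) 0 = (-1) ^ j * ((2 * j).factorial / (2 ^ j * j.factorial) : ℝ) := by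
  have h := Polynomial.coeff_hermite_explicit j 0
  simp only [add_zero, Nat.choose_zero_right] at h
  rw [herm, ← Polynomial.coeff_zero_eq_aeval_zero', h]
  rcases j with _ | j
  · simp
  · have h2 := Nat.factorial_eq_mul_doubleFactorial (2 * j + 1)
    rw [show 2 * j + 1 + 1 = 2 * (j + 1) by ring, Nat.doubleFactorial_two_mul] at h2
    rw [h2, show 2 * (j + 1) - 1 = 2 * j + 1 by omega]
    push_cast
    field_simp

lemma doubleFactorial_odd_le (j : ℕ) :
    (2 * j + 1).doubleFactorial ≤ (2 * (j + 1)).doubleFactorial := by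
  induction j with
  | zero => simp
  | succ j ih =>
    rw [show 2 * (j + 1) + 1 = (2 * j + 1) + 2 by ring,
      show 2 * (j + 1 + 1) = 2 * (j + 1) + 2 by ring, Nat.doubleFactorial_add_two,
      Nat.doubleFactorial_add_two]
    exact Nat.mul_le_mul (by omega) ih

/-- For `k = 2j` the value is `±(2j - 1)!!`, and `(2j - 1)!! ≤ (2j)!!` while their product is
`(2j)!`. -/
lemma herm_zero_sq_le (k : ℕ) : herm k 0 ^ 2 ≤ k.factorial := by
  rcases Nat.even_or_odd' k with ⟨j, rfl | rfl⟩
  · have h3 : (2 * j).factorial ≤ (2 ^ j * j.factorial) ^ 2 := by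
      rcases j with _ | j
      · simp
      · have h2 := Nat.factorial_eq_mul_doubleFactorial (2 * j + 1)
        rw [show 2 * j + 1 + 1 = 2 * (j + 1) by ring] at h2
        rw [← Nat.doubleFactorial_two_mul, h2, sq]
        exact Nat.mul_le_mul_left _ (doubleFactorial_odd_le j)
    have h4 : ((2 * j).factorial : ℝ) ≤ (2 ^ j * j.factorial : ℝ) ^ 2 := by exact_mod_cast h3
    have h5 : (((-1) ^ j) ^ 2 : ℝ) = 1 := by rw [← pow_mul, mul_comm, pow_mul]; simp
    rw [herm_zero_even, mul_pow, div_pow, h5, one_mul, div_le_iff₀ (by positivity), sq]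
    gcongr
  · rw [herm_zero_odd]; simp

/-- Only even `k` contribute, and there are `(N + 1) / 2` of them below `N`; what remains is a
partial sum of the series of `exp (-t²/2)`. -/
lemma sum_herm_zero_eq (N : ℕ) (t : ℝ) :
    ∑ k ∈ Finset.range N, (-1) ^ k * herm k 0 / (k.factorial : ℝ) * t ^ k =
      ∑ j ∈ Finset.range ((N + 1) / 2), (-(t ^ 2 / 2)) ^ j / (j.factorial : ℝ) := by
  induction N with
  | zero => simp
  | succ N ih =>
    rw [Finset.sum_range_succ, ih]
    rcases Nat.even_or_odd' N with ⟨j, rfl | rfl⟩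
    · rw [show (2 * j + 1 + 1) / 2 = (2 * j + 1) / 2 + 1 by omega, Finset.sum_range_succ,
        show (2 * j + 1) / 2 = j by omega, herm_zero_even]
      congr 1
      rw [neg_pow (t ^ 2 / 2), div_pow, pow_mul t, pow_mul (-1 : ℝ) 2 j]
      field_simp
      simp
    · rw [herm_zero_odd, show (2 * j + 1 + 1 + 1) / 2 = (2 * j + 1 + 1) / 2 by omega]; simp

/-- The second derivative of `G` is the normal density, whose truncated series has an
alternating-type remainder. The mean value inequality, applied twice from `0`, contributes the
factor `w²`. -/
lemma abs_G_sub_taylorG_le (β : ℝ) (N : ℕ) (w : ℝ) :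
    |G w β - taylorG β N w| ≤
      w ^ 2 * ((w ^ 2 / 2) ^ ((N + 1) / 2) / (((N + 1) / 2).factorial : ℝ)) := by
  set J := (N + 1) / 2 with hJ
  set B := (w ^ 2 / 2) ^ J / (J.factorial : ℝ)
  have hB : 0 ≤ B := by positivity
  let a : ℕ → ℝ := fun k => (-1) ^ k * herm k 0 / (k.factorial : ℝ)
  let f1 : ℝ → ℝ := fun t => stdCdf t - stdCdf 0 -
    stdPdf 0 * ∑ k ∈ Finset.range N, a k / (k + 1) * t ^ (k + 1)
  let f2 : ℝ → ℝ := fun t => stdPdf t - stdPdf 0 * ∑ k ∈ Finset.range N, a k * t ^ k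
  have hf1 : ∀ t, HasDerivAt f1 (f2 t) t := fun t => by
    refine ((hasDerivAt_stdCdf t).sub_const _).sub (HasDerivAt.const_mul _ ?_)
    refine HasDerivAt.fun_sum fun k _ => ?_
    convert! (hasDerivAt_pow (k + 1) t).const_mul (a k / (k + 1)) using 1
    push_cast; field_simp
  have hf : ∀ t, HasDerivAt (fun t => G t β - taylorG β N t) (f1 t) t := fun t => by
    have h1 : HasDerivAt (taylorG β N) (0 + (stdCdf 0 - β) * 1 +
        stdPdf 0 * ∑ k ∈ Finset.range N, a k / (k + 1) * t ^ (k + 1)) t := by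
      unfold taylorG
      rw [(hasDerivAt_G 0 β).deriv]
      refine ((hasDerivAt_const t _).add ((hasDerivAt_id t).const_mul _)).add
        (HasDerivAt.const_mul _ (HasDerivAt.fun_sum fun k _ => ?_))
      convert! (hasDerivAt_pow (k + 2) t).const_mul _ using 1
      simp only [a]
      rw [Nat.factorial_succ, Nat.factorial_succ]; push_cast; field_simp
      ring
    convert! (hasDerivAt_G t β).sub h1 using 1
    simp only [f1]; ring
  have h2 : ∀ t ∈ Set.Icc (-|w|) |w|, ‖f2 t‖ ≤ B := fun t ht => by
    have ht2 : t ^ 2 ≤ w ^ 2 := sq_le_sq.2 (abs_le.2 ht)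
    simp only [f2, a]
    rw [sum_herm_zero_eq, ← hJ, stdPdf_eq, ← mul_sub, norm_mul, Real.norm_of_nonneg
      (stdPdf_nonneg 0)]
    refine (mul_le_of_le_one_left (norm_nonneg _) stdPdf_zero_le_one).trans ?_
    refine (abs_exp_neg_sub_sum_le J (by positivity)).trans ?_
    exact div_le_div_of_nonneg_right (pow_le_pow_left₀ (by positivity) (by linarith) J)
      (by positivity)
  have h0 : (0 : ℝ) ∈ Set.Icc (-|w|) |w| := ⟨by simp, abs_nonneg w⟩
  have hw : w ∈ Set.Icc (-|w|) |w| := ⟨neg_abs_le w, le_abs_self w⟩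
  have h1 : ∀ t ∈ Set.Icc (-|w|) |w|, ‖f1 t‖ ≤ B * |w| := fun t ht => by
    have h := (convex_Icc (-|w|) |w|).norm_image_sub_le_of_norm_hasDerivWithin_le
      (fun x _ => (hf1 x).hasDerivWithinAt) h2 h0 ht
    have h3 : f1 0 = 0 := by simp [f1]
    rw [h3, sub_zero, sub_zero] at h
    exact h.trans (mul_le_mul_of_nonneg_left (abs_le.2 ht) hB)
  have h := (convex_Icc (-|w|) |w|).norm_image_sub_le_of_norm_hasDerivWithin_le
      (fun x _ => (hf x).hasDerivWithinAt) h1 h0 hw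
  have h3 : G 0 β - taylorG β N 0 = 0 := by simp [taylorG]
  rw [h3, sub_zero, sub_zero, Real.norm_eq_abs, Real.norm_eq_abs, mul_assoc, ← sq, sq_abs] at h
  linarith

lemma integral_sq_gaussianReal {s : ℝ} (hs : 0 ≤ s) (w : ℝ) :
    ∫ u, u ^ 2 ∂(gaussianReal w s.toNNReal) = w ^ 2 + s := by
  have h := variance_eq_sub (memLp_id_gaussianReal' (μ := w) (v := s.toNNReal) 2 (by simp))
  simp only [variance_id_gaussianReal, Pi.pow_apply, id, integral_id_gaussianReal,
    Real.coe_toNNReal _ hs] at h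
  linarith

lemma integrable_sq_gaussianReal (w : ℝ) (v : ℝ≥0) :
    Integrable (fun u : ℝ => u ^ 2) (gaussianReal w v) := by
  exact (integrable_eval_gaussianReal (Polynomial.X ^ 2) w v).congr
    (ae_of_all _ fun u => by simp)

lemma integral_hermEst_sq_le {β : ℝ} (h0 : 0 ≤ β) (h1 : β ≤ 1) {s : ℝ} (hs : 0 ≤ s) (hs1 : s < 1)
    (N : ℕ) (w : ℝ) :
    ∫ u, hermEst β s N u ^ 2 ∂(gaussianReal w s.toNNReal) ≤
      (N + 2) ^ 2 * Real.exp (w ^ 2 / (1 - s)) := by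
  set μ := gaussianReal w s.toNNReal
  set E := Real.exp (w ^ 2 / (1 - s))
  let c : ℕ → ℝ := fun k => stdPdf 0 * ((-1) ^ k * herm k 0 / ((k + 2).factorial : ℝ))
  set D := deriv (fun w => G w β) 0 with hD
  have hphi := stdPdf_zero_sq_le
  have hE : 1 + w ^ 2 ≤ E := by
    have h3 : w ^ 2 ≤ w ^ 2 / (1 - s) := by
      rw [le_div_iff₀ (by linarith)]; nlinarith [sq_nonneg w]
    linarith [Real.add_one_le_exp (w ^ 2 / (1 - s))]
  have hD2 : D ^ 2 ≤ 1 := by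
    rw [hD, (hasDerivAt_G 0 β).deriv, sq_le_one_iff_abs_le_one, abs_le]
    constructor <;> linarith [stdCdf_nonneg 0, stdCdf_le_one 0]
  -- The factorials cancel: `H_k(0)² ≤ k!` and the second moment `(k + 3) (k + 2)! E` against `(k +
  -- 2)!²` leave `(k + 3) / (6 (k + 1) (k + 2)) ≤ 1`.
  have hc : ∀ k, c k ^ 2 * ∫ u, scaledHerm (k + 2) s u ^ 2 ∂μ ≤ E := fun k => by
    have h2 := integral_scaledHerm_sq_le (k + 2) hs hs1 w
    have h3 := herm_zero_sq_le k
    have h4 : ((k + 2).factorial : ℝ) = (k + 2) * ((k + 1) * k.factorial) := by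
      rw [Nat.factorial_succ, Nat.factorial_succ]; push_cast; ring
    have h5 : c k ^ 2 ≤ 1 / 6 * (k.factorial / ((k + 2).factorial : ℝ) ^ 2) := by
      simp only [c]
      rw [mul_pow, div_pow, mul_pow, ← pow_mul, mul_comm k 2, pow_mul]
      simp only [even_two, Even.neg_pow, one_pow, one_mul]
      gcongr
    calc _ ≤ 1 / 6 * (k.factorial / ((k + 2).factorial : ℝ) ^ 2) *
          (((k + 2 : ℕ) + 1) * ((k + 2).factorial * E)) := by
            gcongr
      _ = (k + 3) / (6 * ((k + 2) * (k + 1))) * E := by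
            rw [h4]; push_cast; field_simp; ring
      _ ≤ 1 * E := by
            gcongr
            rw [div_le_one (by positivity)]
            nlinarith [(Nat.cast_nonneg k : (0 : ℝ) ≤ k)]
      _ = E := one_mul _
  have hI : ∀ k, Integrable (fun u => (c k * scaledHerm (k + 2) s u) ^ 2) μ := fun k => by
    simpa only [mul_pow] using (integrable_scaledHerm_sq (k + 2) s w _).const_mul (c k ^ 2)
  have hI2 : Integrable (fun u => (D * u) ^ 2) μ := by
    simpa only [mul_pow] using (integrable_sq_gaussianReal w _).const_mul (D ^ 2)
  have hI3 : Integrable (fun u => G 0 β ^ 2 + (D * u) ^ 2) μ := (integrable_const _).add hI2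
  have hI4 : Integrable (fun u => ∑ k ∈ Finset.range N, (c k * scaledHerm (k + 2) s u) ^ 2) μ :=
    integrable_finsetSum _ fun k _ => hI k
  have hpt : ∀ u, hermEst β s N u ^ 2 ≤ (N + 2) * (G 0 β ^ 2 + (D * u) ^ 2 +
      ∑ k ∈ Finset.range N, (c k * scaledHerm (k + 2) s u) ^ 2) := fun u => by
    -- Listing the constant and linear terms with the others lets a single Cauchy–Schwarz inequality
    -- over `N + 2` terms suffice.
    let F : ℕ → ℝ := fun i => if i = 0 then G 0 β else if i = 1 then D * u else
      c (i - 2) * scaledHerm i s u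
    have h2 : hermEst β s N u = ∑ i ∈ Finset.range (N + 2), F i := by
      rw [Finset.sum_range_succ', Finset.sum_range_succ']
      simp only [F, hermEst, c, Finset.mul_sum]
      simp [mul_assoc, ← hD]; ring
    rw [h2]
    refine sq_sum_le_card_mul_sum_sq.trans_eq ?_
    rw [Finset.sum_range_succ', Finset.sum_range_succ']
    simp only [F, Finset.card_range]
    simp only [Nat.add_eq_zero_iff, one_ne_zero, and_false, if_false, if_true, Nat.add_eq_right,
      zero_add]
    push_cast
    ring
  calc _ ≤ ∫ u, (N + 2 : ℝ) * (G 0 β ^ 2 + (D * u) ^ 2 +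
      ∑ k ∈ Finset.range N, (c k * scaledHerm (k + 2) s u) ^ 2) ∂μ :=
        integral_mono_of_nonneg (ae_of_all _ fun u => sq_nonneg _)
          ((hI3.add hI4).const_mul _) (ae_of_all _ hpt)
    _ = (N + 2 : ℝ) * (G 0 β ^ 2 + D ^ 2 * (w ^ 2 + s) +
      ∑ k ∈ Finset.range N, c k ^ 2 * ∫ u, scaledHerm (k + 2) s u ^ 2 ∂μ) := by
        rw [integral_const_mul, integral_add hI3 hI4, integral_add (integrable_const _) hI2,
          integral_finsetSum _ fun k _ => hI k]
        simp only [mul_pow, integral_const_mul]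
        rw [integral_sq_gaussianReal hs]
        simp
    _ ≤ (N + 2 : ℝ) * (1 + 1 * (w ^ 2 + 1) + ∑ k ∈ Finset.range N, E) := by
        have h3 : |G 0 β| ≤ 1 := by simpa using abs_G_le h0 h1 0
        have h4 : G 0 β ^ 2 ≤ 1 := by rwa [sq_le_one_iff_abs_le_one]
        gcongr
        exact hc _
    _ ≤ (N + 2 : ℝ) * ((N + 2) * E) := by
        gcongr
        simp only [Finset.sum_const, Finset.card_range, nsmul_eq_mul]
        nlinarith
    _ = _ := by ring

/-! ### Gaussian tails and thresholded functions of independent variables -/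

/-- Chernoff bound with exponent `(a - w) / r` instead of `(a - w) / s`, so that the degenerate case
`s = 0` (`τ = ∞`) is covered. -/
lemma gaussianReal_real_Ici_le {s r : ℝ} (hs : 0 ≤ s) (hsr : s ≤ r) (hr : 0 < r) {w a : ℝ}
    (hwa : w ≤ a) :
    (gaussianReal w s.toNNReal).real (Set.Ici a) ≤ Real.exp (-((a - w) ^ 2 / (2 * r))) := by
  have h := measure_ge_le_exp_mul_mgf (μ := gaussianReal w s.toNNReal) (X := id)
    (t := (a - w) / r) a (div_nonneg (by linarith) hr.le) (integrable_exp_mul_gaussianReal _)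
  rw [mgf_id_gaussianReal, ← Real.exp_add, Real.coe_toNNReal _ hs] at h
  refine h.trans (Real.exp_le_exp.2 ?_)
  have h2 : s * ((a - w) / r) ^ 2 ≤ r * ((a - w) / r) ^ 2 := by gcongr
  have h3 : r * ((a - w) / r) ^ 2 = (a - w) * ((a - w) / r) := by field_simp
  have h4 : (a - w) ^ 2 / (2 * r) = (a - w) * ((a - w) / r) / 2 := by field_simp
  rw [h4]
  nlinarith

lemma gaussianReal_real_Iic_le {s r : ℝ} (hs : 0 ≤ s) (hsr : s ≤ r) (hr : 0 < r) {w a : ℝ}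
    (hwa : a ≤ w) :
    (gaussianReal w s.toNNReal).real (Set.Iic a) ≤ Real.exp (-((w - a) ^ 2 / (2 * r))) := by
  have h := gaussianReal_real_Ici_le hs hsr hr (neg_le_neg hwa)
  rw [← gaussianReal_map_neg, map_measureReal_apply measurable_neg measurableSet_Ici] at h
  simp only [Set.neg_preimage, Set.neg_Ici, neg_neg] at h
  rwa [show -a - -w = w - a by ring] at h

/-- A function of `u` chosen among three according to the position of `v`. -/
noncomputable def threshold (l : ℝ) (f g h : ℝ → ℝ) (p : ℝ × ℝ) : ℝ :=
  if p.2 < -l then f p.1 else if p.2 ≤ l then g p.1 else h p.1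

lemma threshold_eq {l : ℝ} (hl : 0 ≤ l) (f g h : ℝ → ℝ) (p : ℝ × ℝ) :
    threshold l f g h p = f p.1 * (Set.Iio (-l)).indicator 1 p.2 +
      g p.1 * (Set.Icc (-l) l).indicator 1 p.2 + h p.1 * (Set.Ioi l).indicator 1 p.2 := by
  unfold threshold
  by_cases h1 : p.2 < -l
  · have h2 : ¬ (-l ≤ p.2) := not_le.2 h1
    have h3 : ¬ (l < p.2) := by linarith
    simp [h1, h2, h3]
  · by_cases h2 : p.2 ≤ l
    · have h3 : -l ≤ p.2 := not_lt.1 h1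
      simp [h1, h2, h3]
    · have h3 : l < p.2 := not_le.1 h2
      simp [h1, h2, h3]

lemma integrable_threshold {μ ν : Measure ℝ} [SFinite μ] [IsProbabilityMeasure ν] {l : ℝ}
    (hl : 0 ≤ l) {f g h : ℝ → ℝ} (hf : Integrable f μ)
    (hg : Integrable g μ) (hh : Integrable h μ) : Integrable (threshold l f g h) (μ.prod ν) := by
  rw [funext (threshold_eq hl f g h)]
  have hi : ∀ s : Set ℝ, MeasurableSet s → Integrable (s.indicator (1 : ℝ → ℝ)) ν := fun s hs =>
    (integrable_const (1 : ℝ)).indicator hs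
  exact ((hf.mul_prod (hi _ measurableSet_Iio)).add (hg.mul_prod (hi _ measurableSet_Icc))).add
    (hh.mul_prod (hi _ measurableSet_Ioi))

lemma integral_threshold {μ ν : Measure ℝ} [SFinite μ] [IsProbabilityMeasure ν] {l : ℝ}
    (hl : 0 ≤ l) {f g h : ℝ → ℝ} (hf : Integrable f μ)
    (hg : Integrable g μ) (hh : Integrable h μ) :
    ∫ p, threshold l f g h p ∂(μ.prod ν) = ν.real (Set.Iio (-l)) * ∫ u, f u ∂μ +
      ν.real (Set.Icc (-l) l) * ∫ u, g u ∂μ + ν.real (Set.Ioi l) * ∫ u, h u ∂μ := by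
  simp only [threshold_eq hl f g h]
  have hi : ∀ s : Set ℝ, MeasurableSet s → Integrable (s.indicator (1 : ℝ → ℝ)) ν := fun s hs =>
    (integrable_const (1 : ℝ)).indicator hs
  have h1 := hf.mul_prod (hi _ (measurableSet_Iio (a := -l)))
  have h2 := hg.mul_prod (hi _ (measurableSet_Icc (a := -l) (b := l)))
  have h3 := hh.mul_prod (hi _ (measurableSet_Ioi (a := l)))
  have h12 : Integrable (fun p : ℝ × ℝ => f p.1 * (Set.Iio (-l)).indicator 1 p.2 +
      g p.1 * (Set.Icc (-l) l).indicator 1 p.2) (μ.prod ν) := h1.add h2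
  rw [integral_add h12 h3, integral_add h1 h2, integral_prod_mul, integral_prod_mul,
    integral_prod_mul, integral_indicator_one measurableSet_Iio,
    integral_indicator_one measurableSet_Icc, integral_indicator_one measurableSet_Ioi]
  ring

/-- The sum and difference coordinates of an independent Gaussian pair are independent. -/
lemma map_prod_gaussianReal (θ c d : ℝ) (v : ℝ≥0) :
    ((gaussianReal θ v).prod (gaussianReal 0 1)).map
      (fun p : ℝ × ℝ => (c + d * (p.1 + √(v : ℝ) * p.2), c + d * (p.1 - √(v : ℝ) * p.2))) =
    (gaussianReal (c + d * θ) (2 * v * d ^ 2 : ℝ).toNNReal).prod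
      (gaussianReal (c + d * θ) (2 * v * d ^ 2 : ℝ).toNNReal) := by
  set P := (gaussianReal θ v).prod (gaussianReal 0 1) with hP
  have hlX : P.map (fun p => p.1) = gaussianReal θ v := by
    rw [hP]; exact Measure.map_fst_prod.trans (by simp)
  have hlZ : P.map (fun p => p.2) = gaussianReal 0 1 := by
    rw [hP]; exact Measure.map_snd_prod.trans (by simp)
  have hind : IndepFun (fun p : ℝ × ℝ => p.1) (fun p : ℝ × ℝ => p.2) P :=
    indepFun_prod (X := id) (Y := id) measurable_id measurable_id
  have : IsGaussian (P.map (fun p => p.1)) := by rw [hlX]; infer_instance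
  have : IsGaussian (P.map (fun p => p.2)) := by rw [hlZ]; infer_instance
  have hgX : HasGaussianLaw (fun p : ℝ × ℝ => p.1) P := IsGaussian.hasGaussianLaw
  have hgZ : HasGaussianLaw (fun p : ℝ × ℝ => p.2) P := IsGaussian.hasGaussianLaw
  have hg := hind.hasGaussianLaw hgX hgZ
  set r := √(v : ℝ)
  have hr : r ^ 2 = v := Real.sq_sqrt v.2
  have hX2 := hgX.memLp_two
  have hZ2 := hgZ.memLp_two
  set A : ℝ × ℝ → ℝ := fun p => d * p.1 with hA
  set B : ℝ × ℝ → ℝ := fun p => d * r * p.2 with hB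
  have hA2 : MemLp A 2 P := hX2.const_mul d
  have hB2 : MemLp B 2 P := hZ2.const_mul (d * r)
  have hg2 : HasGaussianLaw (fun p : ℝ × ℝ => ((A + B) p, (A - B) p)) P :=
    hg.map_fun ((d • ContinuousLinearMap.fst ℝ ℝ ℝ + (d * r) • ContinuousLinearMap.snd ℝ ℝ ℝ).prod
      (d • ContinuousLinearMap.fst ℝ ℝ ℝ - (d * r) • ContinuousLinearMap.snd ℝ ℝ ℝ))
  have hvX : Var[fun p : ℝ × ℝ => p.1; P] = v := by
    have := variance_id_gaussianReal (μ := θ) (v := v)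
    rwa [← hlX, variance_id_map (by fun_prop)] at this
  have hvZ : Var[fun p : ℝ × ℝ => p.2; P] = 1 := by
    have := variance_id_gaussianReal (μ := 0) (v := 1)
    rwa [← hlZ, variance_id_map (by fun_prop), NNReal.coe_one] at this
  -- The covariance is `Var A - Var B`. The added noise has exactly the variance of the observation,
  -- so this is zero, and for a jointly Gaussian pair that means independence.
  have hcov : cov[A + B, A - B; P] = 0 := by
    rw [covariance_add_left hA2 hB2 (hA2.sub hB2), covariance_sub_right hA2 hA2 hB2,
      covariance_sub_right hB2 hA2 hB2, covariance_comm A B, covariance_self hA2.aemeasurable,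
      covariance_self hB2.aemeasurable, hA, hB, variance_const_mul, variance_const_mul, hvX, hvZ,
      ← hr]
    ring
  have hind2 := hg2.indepFun_of_covariance_eq_zero hcov
  have hmarg : ∀ e : ℝ, e ^ 2 = d ^ 2 * v → P.map (fun p => c + (d * p.1 + e * p.2)) =
      gaussianReal (c + d * θ) (2 * v * d ^ 2 : ℝ).toNNReal := by
    intro e he
    have h1 : P.map (fun p => d * p.1) = gaussianReal (d * θ)
        (NNReal.mk (d ^ 2) (sq_nonneg _) * v) := by
      rw [← gaussianReal_map_const_mul, ← hlX, Measure.map_map (by fun_prop) (by fun_prop)]; rfl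
    have h2 : P.map (fun p => e * p.2) = gaussianReal (e * 0)
        (NNReal.mk (e ^ 2) (sq_nonneg _) * 1) := by
      rw [← gaussianReal_map_const_mul, ← hlZ, Measure.map_map (by fun_prop) (by fun_prop)]; rfl
    have h3 := gaussianReal_add_gaussianReal_of_indepFun
      (hind.comp (measurable_const_mul d) (measurable_const_mul e)) h1 h2
    have h4 : P.map (fun p => c + (d * p.1 + e * p.2)) =
        (P.map ((fun x => d * x) ∘ (fun p : ℝ × ℝ => p.1) +
          (fun x => e * x) ∘ (fun p : ℝ × ℝ => p.2))).map (fun x => c + x) := by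
      rw [Measure.map_map (by fun_prop) (by fun_prop)]; rfl
    rw [h4, h3, gaussianReal_map_const_add]
    congr 1
    · ring
    · ext
      rw [Real.coe_toNNReal _ (by positivity)]
      push_cast
      simp only [he]
      ring
  have hind3 := hind2.comp (measurable_const_add c) (measurable_const_add c)
  rw [indepFun_iff_map_prod_eq_prod_map_map (by fun_prop) (by fun_prop)] at hind3
  have e1 := hmarg (d * r) (by rw [mul_pow, hr])
  have e2 := hmarg (-(d * r)) (by rw [neg_sq, mul_pow, hr])
  have e3 : (fun x => c + x) ∘ (A + B) = fun p => c + (d * p.1 + d * r * p.2) := rfl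
  have e4 : (fun x => c + x) ∘ (A - B) = fun p => c + (d * p.1 + -(d * r) * p.2) := by
    ext p; simp only [Function.comp, A, B, Pi.sub_apply]; ring
  rw [e3, e1, e4, e2] at hind3
  rw [← hind3]
  congr 1
  ext p
  · ring
  · ring

/-! ### Truncation and the moments of one coordinate -/

/-- Truncation to absolute value at most `n`. -/
noncomputable def clip (n x : ℝ) : ℝ := Real.sign x * min |x| n

lemma clip_eq {n : ℝ} (hn : 0 ≤ n) (x : ℝ) : clip n x = max (-n) (min x n) := by
  rcases lt_trichotomy x 0 with hx | rfl | hx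
  · rw [clip, Real.sign_of_neg hx, abs_of_neg hx, min_eq_left (by linarith : x ≤ n)]
    rcases le_total (-x) n with h | h
    · rw [min_eq_left h, max_eq_right (by linarith)]; ring
    · rw [min_eq_right h, max_eq_left (by linarith)]; ring
  · simp [clip, hn]
  · rw [clip, Real.sign_of_pos hx, abs_of_pos hx, max_eq_right, one_mul]
    exact le_min (by linarith) (by linarith)

lemma continuous_clip {n : ℝ} (hn : 0 ≤ n) : Continuous (clip n) := by
  rw [funext (clip_eq hn)]; fun_prop

lemma abs_clip_le {n : ℝ} (hn : 0 ≤ n) (x : ℝ) : |clip n x| ≤ n := by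
  rw [clip_eq hn, abs_le]
  exact ⟨le_max_left _ _, max_le (by linarith) (min_le_right _ _)⟩

lemma abs_clip_le_abs {n : ℝ} (hn : 0 ≤ n) (x : ℝ) : |clip n x| ≤ |x| := by
  rw [clip, abs_mul, abs_of_nonneg (le_min (abs_nonneg x) hn)]
  have h : |Real.sign x| ≤ 1 := by
    rcases Real.sign_apply_eq x with h | h | h <;> simp [h]
  calc _ ≤ 1 * |x| := mul_le_mul h (min_le_left _ _) (le_min (abs_nonneg x) hn) zero_le_one
    _ = |x| := one_mul _

/-- Where the clip acts the error is at most `|x|`, and there `|x| ≥ n`. This turns a second moment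
into a bound on the clipping bias. -/
lemma abs_clip_sub_le {n : ℝ} (hn : 0 < n) (x : ℝ) : |clip n x - x| ≤ x ^ 2 / n := by
  rw [le_div_iff₀ hn, ← sq_abs x]
  have h0 := abs_nonneg x
  rcases le_total |x| n with h | h
  · rw [clip_eq hn.le, min_eq_left (abs_le.1 h).2, max_eq_right (abs_le.1 h).1]
    simp [sq_nonneg]
  · have h2 : |clip n x - x| ≤ |x| := by
      rw [clip_eq hn.le]
      rcases le_total 0 x with hx | hx
      · rw [abs_of_nonneg hx] at h
        rw [min_eq_right h, max_eq_right (by linarith), abs_of_nonpos (by linarith),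
          abs_of_nonneg hx]
        linarith
      · rw [abs_of_nonpos hx] at h
        rw [min_eq_left (by linarith), max_eq_left (by linarith), abs_of_nonneg (by linarith),
          abs_of_nonpos hx]
        linarith
    nlinarith

lemma sq_integral_le_integral_sq {Ω : Type*} {m : MeasurableSpace Ω} {P : Measure Ω}
    [IsProbabilityMeasure P] {f : Ω → ℝ} (hf : MemLp f 2 P) :
    (∫ x, f x ∂P) ^ 2 ≤ ∫ x, f x ^ 2 ∂P := by
  have h := variance_eq_sub hf
  have h2 := variance_nonneg f P
  simp only [Pi.pow_apply] at h
  linarith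

/-- Moments of the conditional expectation of a thresholded function of a Gaussian pair. -/
lemma threshold_condMoments (θ c d : ℝ) (v : ℝ≥0) {l : ℝ} (hl : 0 ≤ l) {f g h : ℝ → ℝ}
    (hf : Measurable f) (hg : Measurable g) (hh : Measurable h) {μ : Measure ℝ}
    (hμ : μ = gaussianReal (c + d * θ) (2 * v * d ^ 2 : ℝ).toNNReal)
    (hf2 : MemLp f 2 μ) (hg2 : MemLp g 2 μ) (hh2 : MemLp h 2 μ) (T : ℝ → ℝ)
    (hT : T = fun x => ∫ z, threshold l f g h
      (c + d * (x + √(v : ℝ) * z), c + d * (x - √(v : ℝ) * z))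
      ∂(gaussianReal 0 1)) :
    MemLp T 2 (gaussianReal θ v) ∧
    ∫ x, T x ∂(gaussianReal θ v) = μ.real (Set.Iio (-l)) * ∫ u, f u ∂μ +
      μ.real (Set.Icc (-l) l) * ∫ u, g u ∂μ + μ.real (Set.Ioi l) * ∫ u, h u ∂μ ∧
    ∫ x, T x ^ 2 ∂(gaussianReal θ v) ≤ μ.real (Set.Iio (-l)) * ∫ u, f u ^ 2 ∂μ +
      μ.real (Set.Icc (-l) l) * ∫ u, g u ^ 2 ∂μ + μ.real (Set.Ioi l) * ∫ u, h u ^ 2 ∂μ := by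
  have : IsProbabilityMeasure μ := by rw [hμ]; infer_instance
  have hmap := map_prod_gaussianReal θ c d v
  rw [← hμ] at hmap
  set e : ℝ × ℝ → ℝ × ℝ := fun p => (c + d * (p.1 + √(v : ℝ) * p.2), c + d * (p.1 - √(v : ℝ) * p.2))
    with he
  have hem : Measurable e := by fun_prop
  have hsq : ∀ p, threshold l f g h p ^ 2 =
      threshold l (fun u => f u ^ 2) (fun u => g u ^ 2) (fun u => h u ^ 2) p := fun p => by
    unfold threshold; split_ifs <;> rfl
  have hmeas : Measurable (threshold l f g h) :=
    Measurable.ite (measurableSet_lt measurable_snd measurable_const) (hf.comp measurable_fst)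
      (Measurable.ite (measurableSet_le measurable_snd measurable_const) (hg.comp measurable_fst)
        (hh.comp measurable_fst))
  have hi1 : Integrable (threshold l f g h) (μ.prod μ) :=
    integrable_threshold hl (hf2.integrable one_le_two) (hg2.integrable one_le_two)
      (hh2.integrable one_le_two)
  have hi2 : Integrable (fun p => threshold l f g h p ^ 2) (μ.prod μ) := by
    simp only [hsq]
    exact integrable_threshold hl hf2.integrable_sq hg2.integrable_sq hh2.integrable_sq
  have hI1 := integral_threshold (ν := μ) hl (hf2.integrable one_le_two)
    (hg2.integrable one_le_two) (hh2.integrable one_le_two)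
  have hI2 := integral_threshold (ν := μ) hl hf2.integrable_sq hg2.integrable_sq hh2.integrable_sq
  simp only [← hsq] at hI2
  rw [← hmap] at hi1 hi2 hI1 hI2
  rw [integral_map hem.aemeasurable hmeas.aestronglyMeasurable] at hI1
  rw [integral_map hem.aemeasurable (hmeas.pow_const 2).aestronglyMeasurable] at hI2
  have hj1 : Integrable (fun p => threshold l f g h (e p))
      ((gaussianReal θ v).prod (gaussianReal 0 1)) := hi1.comp_measurable hem
  have hj2 : Integrable (fun p => threshold l f g h (e p) ^ 2)
      ((gaussianReal θ v).prod (gaussianReal 0 1)) := hi2.comp_measurable hem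
  rw [integral_prod _ hj1] at hI1
  rw [integral_prod _ hj2] at hI2
  have hTm : StronglyMeasurable T := by
    rw [hT]
    exact StronglyMeasurable.integral_prod_right (f := fun x z => threshold l f g h (e (x, z)))
      (hmeas.comp hem).stronglyMeasurable
  -- Jensen: averaging over the noise does not increase the second moment.
  have hle : ∀ᵐ x ∂(gaussianReal θ v),
      T x ^ 2 ≤ ∫ z, threshold l f g h (e (x, z)) ^ 2 ∂(gaussianReal 0 1) := by
    filter_upwards [hj2.prod_right_ae] with x hx
    rw [hT]
    exact sq_integral_le_integral_sq ((memLp_two_iff_integrable_sq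
      ((hmeas.comp hem).comp measurable_prodMk_left).aestronglyMeasurable).2 hx)
  have hint : Integrable (fun x => T x ^ 2) (gaussianReal θ v) :=
    hj2.integral_prod_left.mono' (hTm.measurable.pow_const 2).aestronglyMeasurable (by
      filter_upwards [hle] with x hx
      rwa [Real.norm_of_nonneg (sq_nonneg _)])
  refine ⟨(memLp_two_iff_integrable_sq hTm.aestronglyMeasurable).2 hint, ?_, ?_⟩
  · rw [hT]; exact hI1
  · rw [← hI2]
    exact integral_mono_ae hint hj2.integral_prod_left hle

namespace Coord

variable (C : Coord)

/-- The argument `c + d θ` of `G` in the risk. -/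
noncomputable def arg (τ : ℝ≥0∞) (θ : ℝ) : ℝ := C.c τ + C.d τ * θ

/-- The variance of the randomized argument. -/
noncomputable def noiseVar (τ : ℝ≥0∞) : ℝ := 2 * C.sp * C.d τ ^ 2

lemma ratio_pos : 0 < C.ratio := div_pos C.b_pos (add_pos C.b_pos C.h_pos)

lemma ratio_lt_one : C.ratio < 1 := by
  rw [ratio, div_lt_one (add_pos C.b_pos C.h_pos)]; linarith [C.h_pos]

lemma noiseVar_nonneg (τ : ℝ≥0∞) : 0 ≤ C.noiseVar τ := by unfold noiseVar; positivity

lemma STrunc_eq (γ : ℝ) (n : ℕ) (τ : ℝ≥0∞) (u : ℝ) :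
    C.STrunc γ n τ u = clip n (hermEst C.ratio (C.noiseVar τ) (C.order γ n - 1) u) := rfl

lemma integral_affine_sq_gaussianReal (r w g : ℝ) {s : ℝ} (hs : 0 ≤ s) :
    ∫ u, (r * u - g) ^ 2 ∂(gaussianReal w s.toNNReal) = r ^ 2 * s + (r * w - g) ^ 2 := by
  have h1 := (integrable_sq_gaussianReal w s.toNNReal).const_mul (r ^ 2)
  have h2 := (integrable_id_gaussianReal w s.toNNReal).const_mul (-2 * r * g)
  have h12 : Integrable (fun u => r ^ 2 * u ^ 2 + -2 * r * g * u) (gaussianReal w s.toNNReal) :=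
    h1.add h2
  have : ∀ u, (r * u - g) ^ 2 = r ^ 2 * u ^ 2 + -2 * r * g * u + g ^ 2 := fun u => by ring
  simp only [this]
  rw [integral_add h12 (integrable_const _), integral_add h1 h2, integral_const_mul,
    integral_const_mul, integral_sq_gaussianReal hs, integral_id_gaussianReal]
  simp
  ring

lemma memLp_affine_gaussianReal (r w g : ℝ) (v : ℝ≥0) :
    MemLp (fun u => r * u - g) 2 (gaussianReal w v) :=
  ((memLp_id_gaussianReal' 2 (by simp)).const_mul r).sub (memLp_const g)

/-- Centring all three branches at `G(w)` leaves mean errors `-posMean w` and `-posMean (-w)` in the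
outer ones, so only the middle branch needs Taylor expansion. -/
lemma centered_T_moments (γ : ℝ) (n : ℕ) (τ : ℝ≥0∞) (θ : ℝ) (hl : 0 ≤ thr γ n) :
    let μ := gaussianReal (C.arg τ θ) (C.noiseVar τ).toNNReal
    let g := G (C.arg τ θ) C.ratio
    MemLp (fun x => C.T γ n τ x - g) 2 (gaussianReal θ C.sp) ∧
    ∫ x, (C.T γ n τ x - g) ∂(gaussianReal θ C.sp) =
      μ.real (Set.Iio (-thr γ n)) * -posMean (C.arg τ θ) +
      μ.real (Set.Icc (-thr γ n) (thr γ n)) * ∫ u, (C.STrunc γ n τ u - g) ∂μ +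
      μ.real (Set.Ioi (thr γ n)) * -posMean (-C.arg τ θ) ∧
    ∫ x, (C.T γ n τ x - g) ^ 2 ∂(gaussianReal θ C.sp) ≤
      μ.real (Set.Iio (-thr γ n)) * (C.noiseVar τ + posMean (C.arg τ θ) ^ 2) +
      μ.real (Set.Icc (-thr γ n) (thr γ n)) * ∫ u, (C.STrunc γ n τ u - g) ^ 2 ∂μ +
      μ.real (Set.Ioi (thr γ n)) * (C.noiseVar τ + posMean (-C.arg τ θ) ^ 2) := by
  intro μ g
  have h0 := C.ratio_pos
  have h1 := C.ratio_lt_one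
  have hs := C.noiseVar_nonneg τ
  have hSm : Continuous (C.STrunc γ n τ) :=
    (continuous_clip (Nat.cast_nonneg n)).comp (continuous_hermEst _ _ _)
  have hS2 : MemLp (fun u => C.STrunc γ n τ u - g) 2 μ := by
    refine MemLp.sub ?_ (memLp_const g)
    exact (memLp_const (n : ℝ)).of_le hSm.aestronglyMeasurable (ae_of_all _ fun u => by
      rw [STrunc_eq, Real.norm_eq_abs, Real.norm_eq_abs]
      exact (abs_clip_le (Nat.cast_nonneg n) _).trans (le_abs_self _))
  have hfin : ∀ r, MemLp (fun u => r * u - g) 2 μ := fun r => memLp_affine_gaussianReal r _ g _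
  let F : ℝ × ℝ → ℝ := threshold (thr γ n) (fun u => -C.ratio * u) (C.STrunc γ n τ)
    (fun u => (1 - C.ratio) * u)
  let F' : ℝ × ℝ → ℝ := threshold (thr γ n) (fun u => -C.ratio * u - g)
    (fun u => C.STrunc γ n τ u - g) (fun u => (1 - C.ratio) * u - g)
  have hFF : ∀ p, F' p = F p - g := fun p => by
    simp only [F, F', threshold]; split_ifs <;> rfl
  have hFb : ∀ p, |F p| ≤ |p.1| + n := fun p => by
    have hp := abs_nonneg p.1
    have hn : (0 : ℝ) ≤ n := Nat.cast_nonneg n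
    simp only [F, threshold]
    split_ifs
    · rw [abs_mul, abs_neg, abs_of_pos h0]; nlinarith
    · rw [STrunc_eq]
      linarith [abs_clip_le hn (hermEst C.ratio (C.noiseVar τ) (C.order γ n - 1) p.1)]
    · rw [abs_mul, abs_of_pos (by linarith)]; nlinarith
  have hFm : Measurable F :=
    Measurable.ite (measurableSet_lt measurable_snd measurable_const)
      (by fun_prop) (Measurable.ite (measurableSet_le measurable_snd measurable_const)
        (hSm.measurable.comp measurable_fst) (by fun_prop))
  have hT : (fun x => C.T γ n τ x - g) = fun x => ∫ z, F' (C.c τ + C.d τ * (x + √(C.sp : ℝ) * z),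
      C.c τ + C.d τ * (x - √(C.sp : ℝ) * z)) ∂(gaussianReal 0 1) := by
    ext x
    have hi : Integrable (fun z => F (C.c τ + C.d τ * (x + √(C.sp : ℝ) * z),
        C.c τ + C.d τ * (x - √(C.sp : ℝ) * z))) (gaussianReal 0 1) := by
      have hb : Integrable (fun z => |C.c τ + C.d τ * (x + √(C.sp : ℝ) * z)| + n)
          (gaussianReal 0 1) := by
        refine Integrable.add (Integrable.abs ?_) (integrable_const _)
        exact (integrable_const _).add (((integrable_const _).add
          ((integrable_id_gaussianReal 0 1).const_mul _)).const_mul _)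
      exact hb.mono' (hFm.comp (by fun_prop)).aestronglyMeasurable (ae_of_all _ fun z => hFb _)
    simp only [hFF]
    rw [integral_sub hi (integrable_const _)]
    simp only [integral_const, probReal_univ, one_smul]
    rfl
  obtain ⟨k1, k2, k3⟩ := threshold_condMoments θ (C.c τ) (C.d τ) C.sp hl (by fun_prop)
    (by fun_prop) (by fun_prop) (μ := μ) rfl (hfin (-C.ratio)) hS2 (hfin (1 - C.ratio)) _ hT
  have hint : ∀ r, ∫ u, (r * u - g) ∂μ = r * C.arg τ θ - g := fun r => by
    rw [integral_sub ((integrable_id_gaussianReal _ _).const_mul r) (integrable_const _),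
      integral_const_mul, integral_id_gaussianReal]
    simp
  have e1 : -C.ratio * C.arg τ θ - g = -posMean (C.arg τ θ) := by
    simp only [g, G, posMean]; ring
  have e2 : (1 - C.ratio) * C.arg τ θ - g = -posMean (-C.arg τ θ) := by
    have := posMean_sub_posMean_neg (C.arg τ θ)
    simp only [g, G_eq]
    linear_combination (-(1 - C.ratio)) * this
  refine ⟨k1, ?_, ?_⟩
  · rw [k2, hint, hint, e1, e2]
  · refine k3.trans ?_
    rw [integral_affine_sq_gaussianReal _ _ _ hs, integral_affine_sq_gaussianReal _ _ _ hs, e1, e2,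
      neg_sq, neg_sq, neg_sq]
    have i1 : C.ratio ^ 2 * C.noiseVar τ ≤ C.noiseVar τ :=
      mul_le_of_le_one_left hs (by nlinarith)
    have i2 : (1 - C.ratio) ^ 2 * C.noiseVar τ ≤ C.noiseVar τ :=
      mul_le_of_le_one_left hs (by nlinarith)
    gcongr

end Coord

/-! ### Bounds for one coordinate -/

/-- Here `q` is the probability of the upper branch. For `0 ≤ w ≤ l/2` the probability is small, for
`w ≥ l/2` the error `posMean (-w)` is, and for `w ≤ 0` the linear growth of the error is absorbed by
a spare factor `exp (-w²/2)` in the probability. The lower branch follows by replacing `w` with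
`-w`. -/
lemma mul_posMean_neg_le {q w l : ℝ} (hl : 0 ≤ l) (h0 : 0 ≤ q) (h1 : q ≤ 1)
    (hq : w ≤ l → q ≤ Real.exp (-((l - w) ^ 2 / 2))) :
    q * posMean (-w) ≤ 2 * Real.exp (-(l ^ 2 / 8)) ∧ q * posMean (-w) ^ 2 ≤ 4 := by
  have hp := posMean_nonneg (-w)
  rcases le_total 0 w with hw | hw
  · have hp1 := posMean_neg_le_exp hw
    have hp2 : posMean (-w) ≤ 1 := hp1.trans (Real.exp_le_one_iff.2 (by nlinarith))
    refine ⟨?_, by nlinarith [mul_le_mul h1 hp2 hp zero_le_one]⟩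
    have hE := Real.exp_pos (-(l ^ 2 / 8))
    rcases le_total w (l / 2) with h | h
    · have h2 : q ≤ Real.exp (-(l ^ 2 / 8)) :=
        (hq (by linarith)).trans (Real.exp_le_exp.2 (by nlinarith))
      nlinarith
    · have h2 : posMean (-w) ≤ Real.exp (-(l ^ 2 / 8)) :=
        hp1.trans (Real.exp_le_exp.2 (by nlinarith))
      nlinarith
  · have hp1 : posMean (-w) ≤ 1 - w := by
      have := posMean_le_one_add_abs (-w)
      rw [abs_neg, abs_of_nonpos hw] at this
      linarith
    have h2 := hq (by linarith)
    have h3 : Real.exp (-((l - w) ^ 2 / 2)) ≤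
        Real.exp (-(l ^ 2 / 8)) * Real.exp (-(w ^ 2 / 2)) := by
      rw [← Real.exp_add]; exact Real.exp_le_exp.2 (by nlinarith [mul_nonneg hl (neg_nonneg.2 hw)])
    have h4 : Real.exp (-(l ^ 2 / 8)) ≤ 1 := Real.exp_le_one_iff.2 (by nlinarith)
    have h5 : (1 + w ^ 2 / 2) * Real.exp (-(w ^ 2 / 2)) ≤ 1 := by
      have h := Real.add_one_le_exp (w ^ 2 / 2)
      calc _ ≤ Real.exp (w ^ 2 / 2) * Real.exp (-(w ^ 2 / 2)) := by gcongr; linarith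
        _ = 1 := by rw [← Real.exp_add]; simp
    have hE := Real.exp_pos (-(l ^ 2 / 8))
    have hF := Real.exp_pos (-(w ^ 2 / 2))
    constructor
    · calc q * posMean (-w) ≤ (Real.exp (-(l ^ 2 / 8)) * Real.exp (-(w ^ 2 / 2))) *
            (2 * (1 + w ^ 2 / 2)) :=
          mul_le_mul (h2.trans h3) (by nlinarith [sq_nonneg (w + 1)]) hp (by positivity)
        _ = 2 * Real.exp (-(l ^ 2 / 8)) * ((1 + w ^ 2 / 2) * Real.exp (-(w ^ 2 / 2))) := by ring
        _ ≤ 2 * Real.exp (-(l ^ 2 / 8)) * 1 := by gcongr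
        _ = _ := mul_one _
    · have h6 : posMean (-w) ^ 2 ≤ 4 * (1 + w ^ 2 / 2) := by
        nlinarith [sq_nonneg (w + 1), mul_le_mul hp1 hp1 hp (by linarith)]
      calc q * posMean (-w) ^ 2 ≤ (1 * Real.exp (-(w ^ 2 / 2))) * (4 * (1 + w ^ 2 / 2)) := by
            refine mul_le_mul (h2.trans (h3.trans ?_)) h6 (sq_nonneg _) (by positivity)
            gcongr
        _ = 4 * ((1 + w ^ 2 / 2) * Real.exp (-(w ^ 2 / 2))) := by ring
        _ ≤ 4 * 1 := by gcongr
        _ = 4 := mul_one _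

/-- The constraints on the constants of one coordinate: noise ratio `ρ`, threshold constant `γ`,
noise variance `s`, critical ratio `β`. -/
structure Admissible (ρ γ s β : ℝ) : Prop where
  rho_pos : 0 < ρ
  rho_le : ρ ≤ 1 / (4 * Real.exp 1)
  gamma_pos : 0 < γ
  gamma_le : γ ≤ 1 / √(4 * Real.exp 1) - √ρ
  s_nonneg : 0 ≤ s
  s_le : s ≤ 2 * ρ
  beta_nonneg : 0 ≤ β
  beta_le : β ≤ 1

namespace Admissible

/-- With `t = 1/√(4e)` one has `γ ≤ t - √ρ` and `√ρ ≤ t`, so the base is at most `5/4 √2 t`. The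
factor `5/4` exceeds `1` so that a mean outside this window has middle probability below `1/n`, yet
is small enough for `sq_div_le`. -/
lemma sq_le {ρ γ s β : ℝ} (h : Admissible ρ γ s β)
    : (γ + 5 / 4 * √(2 * ρ)) ^ 2 ≤ 25 / (32 * Real.exp 1) := by
  have he := Real.exp_pos 1
  set t := 1 / √(4 * Real.exp 1) with ht
  have ht0 : 0 < t := by positivity
  have ht2 : t ^ 2 = 1 / (4 * Real.exp 1) := by
    rw [ht, div_pow, Real.sq_sqrt (by positivity), one_pow]
  have hr : √ρ ≤ t := by linarith [h.gamma_le, h.gamma_pos]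
  have hq2 : √2 ^ 2 = (2 : ℝ) := Real.sq_sqrt (by norm_num)
  have hq : 1 ≤ √2 := Real.one_le_sqrt.2 (by norm_num)
  rw [Real.sqrt_mul (by norm_num)]
  have h1 : γ + 5 / 4 * (√2 * √ρ) ≤ 5 / 4 * √2 * t := by
    nlinarith [h.gamma_le, mul_nonneg (sub_nonneg.2 hr) (by linarith : 0 ≤ 5 / 4 * √2 - 1)]
  have h0 : 0 ≤ γ + 5 / 4 * (√2 * √ρ) := by have := h.gamma_pos; positivity
  calc _ ≤ (5 / 4 * √2 * t) ^ 2 := by gcongr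
    _ = 25 / 16 * √2 ^ 2 * t ^ 2 := by ring
    _ = _ := by rw [hq2, ht2]; field_simp; norm_num

lemma s_le_half {ρ γ s β : ℝ} (h : Admissible ρ γ s β) : s ≤ 1 / (2 * Real.exp 1) := by
  have := h.s_le.trans (mul_le_mul_of_nonneg_left h.rho_le zero_le_two)
  refine this.trans_eq ?_
  field_simp; norm_num

lemma s_le_quarter {ρ γ s β : ℝ} (h : Admissible ρ γ s β) : s ≤ 1 / 4 := by
  refine h.s_le_half.trans ?_
  rw [div_le_div_iff₀ (by positivity) (by norm_num)]
  linarith [Real.exp_one_gt_d9]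

lemma two_sq_le {ρ γ s β : ℝ} (h : Admissible ρ γ s β) : 2 * (γ + 5 / 4 * √(2 * ρ)) ^ 2 ≤ 1 := by
  have h1 := h.sq_le
  have : 25 / (32 * Real.exp 1) ≤ 1 / 2 := by
    rw [div_le_div_iff₀ (by positivity) (by norm_num)]
    linarith [Real.exp_one_gt_d9]
  linarith

/-- The truncation order is at most linear in `ℓ`. -/
lemma ceil_le {ρ γ s β : ℝ} (h : Admissible ρ γ s β) {ℓ : ℝ} (hℓ : 0 ≤ ℓ) :
    (⌈Real.exp 1 ^ 2 * (γ + √(2 * ρ)) ^ 2 * (2 * ℓ)⌉₊ : ℝ) ≤ 5 * ℓ + 1 := by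
  have he := Real.exp_pos 1
  have h1 := (Nat.ceil_lt_add_one (R := ℝ) (a := Real.exp 1 ^ 2 * (γ + √(2 * ρ)) ^ 2 * (2 * ℓ))
    (by positivity)).le
  have h2 : (γ + √(2 * ρ)) ^ 2 ≤ 25 / (32 * Real.exp 1) := by
    refine le_trans ?_ h.sq_le
    have := h.gamma_pos
    have := Real.sqrt_nonneg (2 * ρ)
    gcongr
    linarith
  have h3 : Real.exp 1 ^ 2 * (γ + √(2 * ρ)) ^ 2 ≤ 5 / 2 := by
    calc _ ≤ Real.exp 1 ^ 2 * (25 / (32 * Real.exp 1)) := by gcongr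
      _ = 25 / 32 * Real.exp 1 := by field_simp
      _ ≤ 5 / 2 := by linarith [Real.exp_one_lt_d9]
  nlinarith

/-- The numerical source of the exponent `3/4`: since `s ≤ 1/(2e)`, it amounts to `25/(16e) ≤ 3/4 (1
- 1/(2e))`, that is `31/16 ≤ 3e/4`. -/
lemma sq_div_le {ρ γ s β : ℝ} (h : Admissible ρ γ s β)
    {ℓ w : ℝ} (hℓ : 0 ≤ ℓ)
    (hw : |w| ≤ (γ + 5 / 4 * √(2 * ρ)) * √(2 * ℓ)) :
    w ^ 2 ≤ ℓ ∧ w ^ 2 / (1 - s) ≤ 3 / 4 * ℓ := by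
  have he := Real.exp_pos 1
  have h1 : w ^ 2 ≤ 2 * (γ + 5 / 4 * √(2 * ρ)) ^ 2 * ℓ := by
    rw [← sq_abs]
    calc _ ≤ ((γ + 5 / 4 * √(2 * ρ)) * √(2 * ℓ)) ^ 2 := by gcongr
      _ = _ := by rw [mul_pow, Real.sq_sqrt (by positivity)]; ring
  refine ⟨h1.trans (mul_le_of_le_one_left hℓ h.two_sq_le), ?_⟩
  have h2 := h.sq_le
  have h3 := h.s_le_half
  rw [div_le_iff₀ (by linarith [h.s_le_quarter])]
  have h4 : 2 * (25 / (32 * Real.exp 1)) ≤ 3 / 4 * (1 - 1 / (2 * Real.exp 1)) := by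
    have : 3 / 4 * (1 - 1 / (2 * Real.exp 1)) - 2 * (25 / (32 * Real.exp 1)) =
      (3 / 4 * Real.exp 1 - 31 / 16) / Real.exp 1 := by field_simp; ring
    have h5 : 0 ≤ (3 / 4 * Real.exp 1 - 31 / 16) / Real.exp 1 :=
      div_nonneg (by linarith [Real.exp_one_gt_d9]) he.le
    linarith
  calc w ^ 2 ≤ 2 * (25 / (32 * Real.exp 1)) * ℓ := h1.trans (by gcongr)
    _ ≤ 3 / 4 * (1 - 1 / (2 * Real.exp 1)) * ℓ := by gcongr
    _ ≤ 3 / 4 * (1 - s) * ℓ := by gcongr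
    _ = _ := by ring

/-- The factor `e²` in the order beats the window's `25/16 ≤ e^(1/2)` and gives `w²/2 ≤ J e^(-3/2)`.
With `J^J / J! ≤ e^J` the remainder is at most `e^(-J/2)`, and `J/2 ≥ γ² ℓ`. -/
lemma taylor_error_le {ρ γ s β : ℝ} (h : Admissible ρ γ s β)
    {ℓ w : ℝ} (hℓ : 0 ≤ ℓ)
    (hw : |w| ≤ (γ + 5 / 4 * √(2 * ρ)) * √(2 * ℓ))
    {N : ℕ} (hN : N = ⌈Real.exp 1 ^ 2 * (γ + √(2 * ρ)) ^ 2 * (2 * ℓ)⌉₊) :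
    |G w β - taylorG β N w| ≤ ℓ * Real.exp (-(γ ^ 2 * ℓ)) := by
  refine (abs_G_sub_taylorG_le β N w).trans ?_
  set J := (N + 1) / 2 with hJ
  have hγ := h.gamma_pos
  have hrt := Real.sqrt_nonneg (2 * ρ)
  have he := Real.exp_pos 1
  have hNJ : (N : ℝ) ≤ 2 * J := by
    have : N ≤ 2 * J := by omega
    exact_mod_cast this
  have hN2 : Real.exp 1 ^ 2 * (γ + √(2 * ρ)) ^ 2 * (2 * ℓ) ≤ N := by
    rw [hN]; exact Nat.le_ceil _
  have h1 : w ^ 2 / 2 ≤ J * Real.exp (-(3 / 2)) := by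
    have h2 : w ^ 2 ≤ (25 / 16) * ((γ + √(2 * ρ)) ^ 2 * (2 * ℓ)) := by
      rw [← sq_abs]
      calc _ ≤ ((γ + 5 / 4 * √(2 * ρ)) * √(2 * ℓ)) ^ 2 := by gcongr
        _ ≤ ((5 / 4 * (γ + √(2 * ρ))) * √(2 * ℓ)) ^ 2 := by gcongr; linarith
        _ = _ := by rw [mul_pow, Real.sq_sqrt (by positivity)]; ring
    have h3 : (25 / 16 : ℝ) ≤ Real.exp (1 / 2) := by
      have := Real.quadratic_le_exp_of_nonneg (x := (1 / 2 : ℝ)) (by norm_num)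
      linarith
    have h4 : Real.exp (-(3 / 2)) * Real.exp 1 ^ 2 = Real.exp (1 / 2) := by
      rw [← Real.exp_nat_mul, ← Real.exp_add]; norm_num
    have h5 : w ^ 2 / 2 * Real.exp 1 ^ 2 ≤ (J * Real.exp (-(3 / 2))) * Real.exp 1 ^ 2 := by
      rw [mul_assoc, h4]
      calc _ ≤ (25 / 16) * ((γ + √(2 * ρ)) ^ 2 * (2 * ℓ)) / 2 * Real.exp 1 ^ 2 := by gcongr
        _ = 25 / 16 * (Real.exp 1 ^ 2 * (γ + √(2 * ρ)) ^ 2 * (2 * ℓ)) / 2 := by ring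
        _ ≤ 25 / 16 * (2 * J) / 2 := by linarith
        _ = J * (25 / 16) := by ring
        _ ≤ J * Real.exp (1 / 2) := by gcongr
    exact le_of_mul_le_mul_right h5 (by positivity)
  have h2 : (w ^ 2 / 2) ^ J / (J.factorial : ℝ) ≤ Real.exp (-(γ ^ 2 * ℓ)) := by
    have h3 := Real.pow_div_factorial_le_exp (J : ℝ) (Nat.cast_nonneg J) J
    calc _ ≤ (J * Real.exp (-(3 / 2))) ^ J / (J.factorial : ℝ) := by gcongr
      _ = (J : ℝ) ^ J / (J.factorial : ℝ) * Real.exp (-(3 / 2)) ^ J := by rw [mul_pow]; ring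
      _ ≤ Real.exp J * Real.exp (-(3 / 2)) ^ J := by gcongr
      _ = Real.exp (-(J / 2)) := by
        rw [← Real.exp_nat_mul, ← Real.exp_add]; congr 1; ring
      _ ≤ _ := by
        refine Real.exp_le_exp.2 (neg_le_neg ?_)
        have h4 : γ ^ 2 ≤ (γ + √(2 * ρ)) ^ 2 := by gcongr; linarith
        have h5 : 2 ≤ Real.exp 1 ^ 2 := by nlinarith [Real.exp_one_gt_d9]
        calc γ ^ 2 * ℓ = 2 * γ ^ 2 * (2 * ℓ) / 4 := by ring
          _ ≤ Real.exp 1 ^ 2 * (γ + √(2 * ρ)) ^ 2 * (2 * ℓ) / 4 := by gcongr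
          _ ≤ J / 2 := by linarith
  have h3 := (h.sq_div_le hℓ hw).1
  gcongr

/-- The probability of the middle region is small when the mean lies far outside. -/
lemma prob_middle_le {ρ γ s β : ℝ} (h : Admissible ρ γ s β)
    {ℓ w : ℝ} (hℓ : 0 ≤ ℓ) (hw : (γ + 5 / 4 * √(2 * ρ)) * √(2 * ℓ) < |w|) :
    (gaussianReal w s.toNNReal).real (Set.Icc (-(γ * √(2 * ℓ))) (γ * √(2 * ℓ))) ≤
      Real.exp (-(5 / 4 * ℓ)) ∧
    (gaussianReal w s.toNNReal).real (Set.Icc (-(γ * √(2 * ℓ))) (γ * √(2 * ℓ))) *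
      (1 + |w|) ^ 2 ≤ 8 * (1 + ℓ) * Real.exp (-(5 / 4 * ℓ)) := by
  set l := γ * √(2 * ℓ) with hl
  set p := (gaussianReal w s.toNNReal).real (Set.Icc (-l) l)
  have hρ := h.rho_pos
  have hγ := h.gamma_pos
  set y := |w| - l with hy
  have hl0 : 0 ≤ l := by positivity
  have hy0 : 5 / 4 * √(2 * ρ) * √(2 * ℓ) ≤ y := by rw [hy, hl]; linarith
  have hy00 : 0 ≤ y := le_trans (by positivity) hy0
  have hp : p ≤ Real.exp (-(y ^ 2 / (2 * (2 * ρ)))) := by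
    rcases le_total 0 w with h0 | h0
    · rw [abs_of_nonneg h0] at hy
      refine (measureReal_mono Set.Icc_subset_Iic_self).trans ?_
      rw [hy]
      exact gaussianReal_real_Iic_le h.s_nonneg h.s_le (by positivity) (by linarith)
    · rw [abs_of_nonpos h0] at hy
      refine (measureReal_mono Set.Icc_subset_Ici_self).trans ?_
      rw [hy, show -w - l = -l - w by ring]
      exact gaussianReal_real_Ici_le h.s_nonneg h.s_le (by positivity) (by linarith)
  have hy1 : 25 / 16 * ℓ ≤ y ^ 2 / (2 * (2 * ρ)) := by
    rw [le_div_iff₀ (by positivity)]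
    calc _ = (5 / 4 * √(2 * ρ) * √(2 * ℓ)) ^ 2 := by
          rw [mul_pow, mul_pow, Real.sq_sqrt (by positivity), Real.sq_sqrt (by positivity)]; ring
      _ ≤ y ^ 2 := by gcongr
  have hy2 : 2 * y ^ 2 ≤ y ^ 2 / (2 * (2 * ρ)) := by
    have h1 : ρ ≤ 1 / 8 := h.rho_le.trans (by
      rw [div_le_div_iff₀ (by positivity) (by norm_num)]; linarith [Real.exp_one_gt_d9])
    rw [le_div_iff₀ (by positivity)]
    nlinarith [sq_nonneg y]
  -- The exponent is split as `4/5 + 1/5`: the first share of `25/16 ℓ` yields `5/4 ℓ`, the second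
  -- share of `2 y²` is kept to absorb the growth of `(1 + |w|)²`.
  have hp2 : p ≤ Real.exp (-(5 / 4 * ℓ)) * Real.exp (-(2 / 5 * y ^ 2)) := by
    refine hp.trans ?_
    rw [← Real.exp_add]
    exact Real.exp_le_exp.2 (by linarith)
  have hE : Real.exp (-(2 / 5 * y ^ 2)) ≤ 1 := Real.exp_le_one_iff.2 (by nlinarith [sq_nonneg y])
  refine ⟨hp2.trans (mul_le_of_le_one_right (Real.exp_pos _).le hE), ?_⟩
  have hl2 : l ^ 2 ≤ ℓ := by
    have h1 := h.two_sq_le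
    have h2 : γ ^ 2 ≤ (γ + 5 / 4 * √(2 * ρ)) ^ 2 := by
      have := Real.sqrt_nonneg (2 * ρ)
      gcongr; linarith
    rw [hl, mul_pow, Real.sq_sqrt (by positivity)]
    nlinarith
  have hw2 : (1 + |w|) ^ 2 ≤ 3 * (1 + ℓ) * (1 + y ^ 2) := by
    have : |w| = y + l := by rw [hy]; ring
    rw [this]
    nlinarith [sq_nonneg (1 - y), sq_nonneg (1 - l), sq_nonneg (y - l),
      mul_nonneg hℓ (sq_nonneg y)]
  have hexp : (1 + y ^ 2) * Real.exp (-(2 / 5 * y ^ 2)) ≤ 5 / 2 := by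
    have h1 := Real.add_one_le_exp (2 / 5 * y ^ 2)
    calc _ ≤ (5 / 2 * Real.exp (2 / 5 * y ^ 2)) * Real.exp (-(2 / 5 * y ^ 2)) := by
          gcongr; linarith
      _ = 5 / 2 := by rw [mul_assoc, ← Real.exp_add]; simp
  calc _ ≤ Real.exp (-(5 / 4 * ℓ)) * Real.exp (-(2 / 5 * y ^ 2)) *
        (3 * (1 + ℓ) * (1 + y ^ 2)) := by gcongr
    _ = 3 * (1 + ℓ) * Real.exp (-(5 / 4 * ℓ)) * ((1 + y ^ 2) * Real.exp (-(2 / 5 * y ^ 2))) := by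
        ring
    _ ≤ 3 * (1 + ℓ) * Real.exp (-(5 / 4 * ℓ)) * (5 / 2) := by gcongr
    _ ≤ _ := by nlinarith [mul_pos (by linarith : 0 < 1 + ℓ) (Real.exp_pos (-(5 / 4 * ℓ)))]

end Admissible

/-! ### Bias and second moment of one coordinate -/

lemma memLp_clip_hermEst {β s : ℝ} {n : ℝ} (hn : 0 ≤ n) (N : ℕ) (w : ℝ) (v : ℝ≥0) :
    MemLp (fun u => clip n (hermEst β s N u)) 2 (gaussianReal w v) :=
  (memLp_const (n : ℝ)).of_le
    ((continuous_clip hn).comp (continuous_hermEst _ _ _)).aestronglyMeasurable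
    (ae_of_all _ fun u => by
      rw [Real.norm_eq_abs, Real.norm_eq_abs]
      exact (abs_clip_le hn _).trans (le_abs_self _))

lemma abs_integral_clip_sub_le {β s n : ℝ} (hs : 0 ≤ s) (hn : 0 < n) (N : ℕ) (w g : ℝ) :
    |∫ u, (clip n (hermEst β s N u) - g) ∂(gaussianReal w s.toNNReal)| ≤
      (∫ u, hermEst β s N u ^ 2 ∂(gaussianReal w s.toNNReal)) / n + |g - taylorG β N w| := by
  set μ := gaussianReal w s.toNNReal
  have h1 : Integrable (fun u => clip n (hermEst β s N u)) μ :=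
    (memLp_clip_hermEst hn.le N w _).integrable one_le_two
  have h2 : Integrable (fun u => hermEst β s N u) μ := integrable_hermEst β s N w _
  have h3 : ∫ u, (clip n (hermEst β s N u) - g) ∂μ =
      ∫ u, (clip n (hermEst β s N u) - hermEst β s N u) ∂μ - (g - taylorG β N w) := by
    rw [integral_sub h1 (integrable_const _), integral_sub h1 h2, integral_hermEst β hs]
    simp
  have h4 : |∫ u, (clip n (hermEst β s N u) - hermEst β s N u) ∂μ| ≤
      (∫ u, hermEst β s N u ^ 2 ∂μ) / n := by
    rw [← integral_div]
    refine norm_integral_le_of_norm_le (f := fun u => clip n (hermEst β s N u) - hermEst β s N u)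
      ((integrable_hermEst_sq β s N w _).div_const n) (ae_of_all _ fun u => abs_clip_sub_le hn _)
  rw [h3]
  exact (abs_sub _ _).trans (add_le_add_left h4 _)

lemma integral_clip_sub_sq_le {β s n : ℝ} (hn : 0 ≤ n) (N : ℕ) (w g : ℝ) (v : ℝ≥0) :
    ∫ u, (clip n (hermEst β s N u) - g) ^ 2 ∂(gaussianReal w v) ≤
      2 * ∫ u, hermEst β s N u ^ 2 ∂(gaussianReal w v) + 2 * g ^ 2 := by
  set μ := gaussianReal w v
  have h1 := (integrable_hermEst_sq β s N w v).const_mul 2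
  calc _ ≤ ∫ u, (2 * hermEst β s N u ^ 2 + 2 * g ^ 2) ∂μ := by
        refine integral_mono_of_nonneg (ae_of_all _ fun u => sq_nonneg _)
          (h1.add (integrable_const _)) (ae_of_all _ fun u => ?_)
        have := sq_le_sq.2 (abs_clip_le_abs hn (hermEst β s N u))
        simp only
        nlinarith [sq_nonneg (clip n (hermEst β s N u) + g)]
    _ = _ := by
        rw [integral_add h1 (integrable_const _), integral_const_mul]
        simp [μ]

/-- Crude bound from the clip level alone, for means so far out that the Hermite second moment is
not controlled. -/
lemma abs_integral_clip_sub_le' {β s n : ℝ} (hn : 0 ≤ n) (N : ℕ) (w g : ℝ) (v : ℝ≥0) :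
    |∫ u, (clip n (hermEst β s N u) - g) ∂(gaussianReal w v)| ≤ n + |g| := by
  have h := norm_integral_le_of_norm_le_const (μ := gaussianReal w v) (C := n + |g|)
    (f := fun u => clip n (hermEst β s N u) - g) (ae_of_all _ fun u =>
      (abs_sub _ _).trans (add_le_add_left (abs_clip_le hn _) _))
  simpa using h

lemma integral_clip_sub_sq_le' {β s n : ℝ} (hn : 0 ≤ n) (N : ℕ) (w g : ℝ) (v : ℝ≥0) :
    ∫ u, (clip n (hermEst β s N u) - g) ^ 2 ∂(gaussianReal w v) ≤ 2 * n ^ 2 + 2 * g ^ 2 := by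
  calc _ ≤ ∫ u, (2 * n ^ 2 + 2 * g ^ 2) ∂(gaussianReal w v) := by
        refine integral_mono_of_nonneg (ae_of_all _ fun u => sq_nonneg _)
          (integrable_const _) (ae_of_all _ fun u => ?_)
        have h1 := abs_clip_le hn (hermEst β s N u)
        have h2 : clip n (hermEst β s N u) ^ 2 ≤ n ^ 2 :=
          sq_le_sq.2 (h1.trans (le_abs_self n))
        simp only
        nlinarith [sq_nonneg (clip n (hermEst β s N u) + g)]
    _ = _ := by simp

/-- Here `exp ℓ` is the sample size. For near `w` the probability is bounded by `1`, and the
clipping bias is `n^(3/4) / n`. For far `w` the probability `n^(-5/4)` multiplies the crude bounds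
`n` and `n²`. Both cases end in `n^(-1/4)` for the bias and `n^(3/4)` for the second moment. -/
lemma middle_bounds {ρ γ s β : ℝ} (h : Admissible ρ γ s β) {ℓ δ : ℝ} (hℓ : 0 ≤ ℓ) (w : ℝ)
    (hδ1 : δ ≤ 1 / 4) (hδ2 : δ ≤ γ ^ 2 / 4) {N : ℕ}
    (hN : N = ⌈Real.exp 1 ^ 2 * (γ + √(2 * ρ)) ^ 2 * (2 * ℓ)⌉₊) :
    (gaussianReal w s.toNNReal).real (Set.Icc (-(γ * √(2 * ℓ))) (γ * √(2 * ℓ))) *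
      |∫ u, (clip (Real.exp ℓ) (hermEst β s N u) - G w β) ∂(gaussianReal w s.toNNReal)| ≤
        26 * (1 + ℓ) ^ 2 * Real.exp (-(δ * ℓ)) ∧
    (gaussianReal w s.toNNReal).real (Set.Icc (-(γ * √(2 * ℓ))) (γ * √(2 * ℓ))) *
      ∫ u, (clip (Real.exp ℓ) (hermEst β s N u) - G w β) ^ 2 ∂(gaussianReal w s.toNNReal) ≤
        54 * (1 + ℓ) ^ 2 * Real.exp (3 / 4 * ℓ) := by
  set μ := gaussianReal w s.toNNReal
  set p := μ.real (Set.Icc (-(γ * √(2 * ℓ))) (γ * √(2 * ℓ)))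
  have hp0 : 0 ≤ p := measureReal_nonneg
  have hp1 : p ≤ 1 := measureReal_le_one
  have hs1 : s < 1 := by linarith [h.s_le_quarter]
  have hn := Real.exp_pos ℓ
  have hG := abs_G_le h.beta_nonneg h.beta_le w
  have hG2 : G w β ^ 2 ≤ (1 + |w|) ^ 2 := by rw [← sq_abs]; gcongr
  have hE1 : (1 : ℝ) ≤ Real.exp (3 / 4 * ℓ) := Real.one_le_exp (by positivity)
  have hEδ : Real.exp (-(1 / 4 * ℓ)) ≤ Real.exp (-(δ * ℓ)) :=
    Real.exp_le_exp.2 (neg_le_neg (by gcongr))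
  rcases le_or_gt |w| ((γ + 5 / 4 * √(2 * ρ)) * √(2 * ℓ)) with hw | hw
  · obtain ⟨hw1, hw2⟩ := h.sq_div_le hℓ hw
    have hS : ∫ u, hermEst β s N u ^ 2 ∂μ ≤ 25 * (1 + ℓ) ^ 2 * Real.exp (3 / 4 * ℓ) := by
      refine (integral_hermEst_sq_le h.beta_nonneg h.beta_le h.s_nonneg hs1 N w).trans ?_
      have h1 : (N : ℝ) + 2 ≤ 5 * (1 + ℓ) := by rw [hN]; linarith [h.ceil_le hℓ]
      calc _ ≤ (5 * (1 + ℓ)) ^ 2 * Real.exp (3 / 4 * ℓ) := by gcongr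
        _ = _ := by ring
    constructor
    · refine (mul_le_of_le_one_left (abs_nonneg _) hp1).trans ?_
      refine (abs_integral_clip_sub_le h.s_nonneg hn N w _).trans ?_
      have h2 := h.taylor_error_le hℓ hw hN
      have h3 : Real.exp (-(γ ^ 2 * ℓ)) ≤ Real.exp (-(δ * ℓ)) :=
        Real.exp_le_exp.2 (neg_le_neg (by gcongr; nlinarith [sq_nonneg γ]))
      have h4 : (∫ u, hermEst β s N u ^ 2 ∂μ) / Real.exp ℓ ≤
          25 * (1 + ℓ) ^ 2 * Real.exp (-(1 / 4 * ℓ)) := by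
        rw [div_le_iff₀ hn, mul_assoc, ← Real.exp_add, show -(1 / 4 * ℓ) + ℓ = 3 / 4 * ℓ by ring]
        exact hS
      calc _ ≤ 25 * (1 + ℓ) ^ 2 * Real.exp (-(δ * ℓ)) + (1 + ℓ) ^ 2 * Real.exp (-(δ * ℓ)) := by
            refine add_le_add (h4.trans (by gcongr)) (h2.trans ?_)
            gcongr
            nlinarith
        _ = _ := by ring
    · refine (mul_le_of_le_one_left (integral_nonneg fun u => sq_nonneg _) hp1).trans ?_
      refine (integral_clip_sub_sq_le hn.le N w _ _).trans ?_
      have h2 : (1 + |w|) ^ 2 ≤ 2 * (1 + ℓ) ^ 2 := by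
        nlinarith [sq_nonneg (1 - |w|), sq_abs w]
      have h3 : (1 + ℓ) ^ 2 ≤ (1 + ℓ) ^ 2 * Real.exp (3 / 4 * ℓ) :=
        le_mul_of_one_le_right (sq_nonneg _) hE1
      linarith
  · obtain ⟨hw1, hw2⟩ := h.prob_middle_le hℓ hw
    have hpg : p * (1 + |w|) ≤ p * (1 + |w|) ^ 2 := by
      gcongr; nlinarith [abs_nonneg w]
    have e1 : Real.exp (-(5 / 4 * ℓ)) * Real.exp ℓ = Real.exp (-(1 / 4 * ℓ)) := by
      rw [← Real.exp_add]; congr 1; ring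
    have e2 : Real.exp (-(5 / 4 * ℓ)) * Real.exp ℓ ^ 2 = Real.exp (3 / 4 * ℓ) := by
      rw [← Real.exp_nat_mul, ← Real.exp_add]; congr 1; push_cast; ring
    have e3 : Real.exp (-(5 / 4 * ℓ)) ≤ Real.exp (-(1 / 4 * ℓ)) :=
      Real.exp_le_exp.2 (by linarith)
    have e5 : 1 + ℓ ≤ (1 + ℓ) ^ 2 := by nlinarith
    have e6 : 1 ≤ (1 + ℓ) ^ 2 := by nlinarith
    constructor
    · calc _ ≤ p * (Real.exp ℓ + (1 + |w|)) := by
            gcongr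
            exact (abs_integral_clip_sub_le' hn.le N w _ _).trans (by gcongr)
        _ = p * Real.exp ℓ + p * (1 + |w|) := by ring
        _ ≤ Real.exp (-(5 / 4 * ℓ)) * Real.exp ℓ + 8 * (1 + ℓ) * Real.exp (-(5 / 4 * ℓ)) := by
            exact add_le_add (mul_le_mul_of_nonneg_right hw1 hn.le) (hpg.trans hw2)
        _ ≤ 1 * Real.exp (-(1 / 4 * ℓ)) + 8 * (1 + ℓ) * Real.exp (-(1 / 4 * ℓ)) := by
            rw [e1, one_mul]; gcongr
        _ = (1 + 8 * (1 + ℓ)) * Real.exp (-(1 / 4 * ℓ)) := by ring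
        _ ≤ 26 * (1 + ℓ) ^ 2 * Real.exp (-(δ * ℓ)) := by gcongr; linarith
    · calc _ ≤ p * (2 * Real.exp ℓ ^ 2 + 2 * (1 + |w|) ^ 2) := by
            gcongr
            exact (integral_clip_sub_sq_le' hn.le N w _ _).trans (by gcongr)
        _ = 2 * (p * Real.exp ℓ ^ 2) + 2 * (p * (1 + |w|) ^ 2) := by ring
        _ ≤ 2 * (Real.exp (-(5 / 4 * ℓ)) * Real.exp ℓ ^ 2) +
              2 * (8 * (1 + ℓ) * Real.exp (-(5 / 4 * ℓ))) := by gcongr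
        _ ≤ 2 * Real.exp (3 / 4 * ℓ) + 2 * (8 * (1 + ℓ) * Real.exp (3 / 4 * ℓ)) := by
            rw [e2]; gcongr; linarith
        _ = (2 + 16 * (1 + ℓ)) * Real.exp (3 / 4 * ℓ) := by ring
        _ ≤ 54 * (1 + ℓ) ^ 2 * Real.exp (3 / 4 * ℓ) := by gcongr; linarith

namespace Coord

variable (C : Coord)

lemma shrink_mem (τ : ℝ≥0∞) : 0 ≤ C.shrink τ ∧ C.shrink τ ≤ 1 := by
  unfold shrink
  have h := C.sp_pos
  have h2 : (0 : ℝ) < C.sp := by exact_mod_cast h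
  split_ifs
  · simp
  · have h3 : 0 ≤ τ.toReal := ENNReal.toReal_nonneg
    exact ⟨by positivity, by rw [div_le_one (by positivity)]; linarith⟩

lemma sf_real_pos : (0 : ℝ) < C.sf := by exact_mod_cast C.sf_pos

lemma sp_real_pos : (0 : ℝ) < C.sp := by exact_mod_cast C.sp_pos

lemma noiseVar_le (τ : ℝ≥0∞) : C.noiseVar τ ≤ 2 * (C.sp / C.sf : ℝ) := by
  obtain ⟨h0, h1⟩ := C.shrink_mem τ
  have hf := C.sf_real_pos
  have hp := C.sp_real_pos
  have hd : C.d τ ^ 2 ≤ 1 / C.sf := by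
    rw [d, neg_sq, div_pow, Real.sq_sqrt (by positivity)]
    have h2 : (1 - C.shrink τ) ^ 2 ≤ 1 := by nlinarith
    have h3 : (C.sf : ℝ) ≤ C.sf + C.sp * C.shrink τ ^ 2 := by
      have : 0 ≤ C.sp * C.shrink τ ^ 2 := by positivity
      linarith
    gcongr
  calc C.noiseVar τ ≤ 2 * C.sp * (1 / C.sf) := by unfold noiseVar; gcongr
    _ = _ := by ring

lemma admissible {γ : ℝ} (hρ : (C.sp / C.sf : ℝ) ≤ 1 / (4 * Real.exp 1)) (hγ0 : 0 < γ)
    (hγ : γ ≤ 1 / √(4 * Real.exp 1) - √(C.sp / C.sf : ℝ)) (τ : ℝ≥0∞) :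
    Admissible (C.sp / C.sf : ℝ) γ (C.noiseVar τ) C.ratio where
  rho_pos := div_pos C.sp_real_pos C.sf_real_pos
  rho_le := hρ
  gamma_pos := hγ0
  gamma_le := hγ
  s_nonneg := C.noiseVar_nonneg τ
  s_le := C.noiseVar_le τ
  beta_nonneg := C.ratio_pos.le
  beta_le := C.ratio_lt_one.le

/-- Bias and mean squared error of the estimate of one coordinate, uniformly in `θ` and `τ`. -/
lemma T_bounds {γ δ : ℝ} (hρ : (C.sp / C.sf : ℝ) ≤ 1 / (4 * Real.exp 1)) (hγ0 : 0 < γ)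
    (hγ : γ ≤ 1 / √(4 * Real.exp 1) - √(C.sp / C.sf : ℝ)) (hδ1 : δ ≤ 1 / 4) (hδ2 : δ ≤ γ ^ 2 / 4)
    {n : ℕ} (hn : 1 ≤ n) (τ : ℝ≥0∞) (θ : ℝ) :
    MemLp (fun x => C.T γ n τ x - G (C.arg τ θ) C.ratio) 2 (gaussianReal θ C.sp) ∧
    |∫ x, (C.T γ n τ x - G (C.arg τ θ) C.ratio) ∂(gaussianReal θ C.sp)| ≤
      30 * (1 + Real.log n) ^ 2 * Real.exp (-(δ * Real.log n)) ∧
    ∫ x, (C.T γ n τ x - G (C.arg τ θ) C.ratio) ^ 2 ∂(gaussianReal θ C.sp) ≤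
      64 * (1 + Real.log n) ^ 2 * Real.exp (3 / 4 * Real.log n) := by
  have h := C.admissible hρ hγ0 hγ τ
  have hn' : (0 : ℝ) < n := by exact_mod_cast hn
  set ℓ := Real.log n with hℓdef
  have hℓ : 0 ≤ ℓ := Real.log_nonneg (by exact_mod_cast hn)
  have hexp : Real.exp ℓ = n := Real.exp_log hn'
  have hl : 0 ≤ thr γ n := by unfold thr; positivity
  obtain ⟨k1, k2, k3⟩ := C.centered_T_moments γ n τ θ hl
  have hN : C.order γ n - 1 =
      ⌈Real.exp 1 ^ 2 * (γ + √(2 * (C.sp / C.sf : ℝ))) ^ 2 * (2 * ℓ)⌉₊ := by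
    rw [order, Nat.add_sub_cancel_left, mul_div_assoc]
  obtain ⟨m1, m2⟩ := middle_bounds h hℓ (C.arg τ θ) hδ1 hδ2 hN
  rw [hexp] at m1 m2
  simp only [STrunc_eq] at k2 k3
  have hthr : γ * √(2 * ℓ) = thr γ n := rfl
  rw [hthr] at m1 m2
  set w := C.arg τ θ
  set s := C.noiseVar τ
  set μ := gaussianReal w s.toNNReal
  have hs1 : s ≤ 1 := by linarith [h.s_le_quarter]
  set q := μ.real (Set.Ioi (thr γ n))
  set a := μ.real (Set.Iio (-thr γ n))
  have hq0 : 0 ≤ q := measureReal_nonneg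
  have hq1 : q ≤ 1 := measureReal_le_one
  have ha0 : 0 ≤ a := measureReal_nonneg
  have ha1 : a ≤ 1 := measureReal_le_one
  obtain ⟨q1, q2⟩ := mul_posMean_neg_le (w := w) hl hq0 hq1 (fun hw => by
    have := gaussianReal_real_Ici_le h.s_nonneg hs1 one_pos hw
    rw [mul_one] at this
    exact (measureReal_mono Set.Ioi_subset_Ici_self).trans this)
  obtain ⟨a1, a2⟩ := mul_posMean_neg_le (w := -w) hl ha0 ha1 (fun hw => by
    have := gaussianReal_real_Iic_le h.s_nonneg hs1 one_pos (neg_le.1 hw)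
    rw [mul_one] at this
    rw [show thr γ n - -w = w - -thr γ n by ring]
    exact (measureReal_mono Set.Iio_subset_Iic_self).trans this)
  rw [neg_neg] at a1 a2
  have hpw := posMean_nonneg w
  have hpw' := posMean_nonneg (-w)
  -- The outer-branch bias is of order `n^(-γ²/4)`, which is where the requirement `δ ≤ γ²/4` comes
  -- from.
  have hexp8 : Real.exp (-(thr γ n ^ 2 / 8)) ≤ (1 + ℓ) ^ 2 * Real.exp (-(δ * ℓ)) := by
    have e1 : thr γ n ^ 2 / 8 = γ ^ 2 / 4 * ℓ := by
      rw [← hthr, mul_pow, Real.sq_sqrt (by positivity)]; ring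
    calc _ ≤ 1 * Real.exp (-(δ * ℓ)) := by
          rw [one_mul, e1]; exact Real.exp_le_exp.2 (neg_le_neg (by gcongr))
      _ ≤ _ := by gcongr; nlinarith
  refine ⟨k1, ?_, ?_⟩
  · rw [k2]
    refine (abs_add_three _ _ _).trans ?_
    rw [abs_mul, abs_mul, abs_mul, abs_neg, abs_neg, abs_of_nonneg hpw, abs_of_nonneg hpw',
      abs_of_nonneg hq0, abs_of_nonneg ha0, abs_of_nonneg measureReal_nonneg]
    linarith
  · refine k3.trans ?_
    have hbig : 1 ≤ (1 + ℓ) ^ 2 * Real.exp (3 / 4 * ℓ) := by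
      have : 1 ≤ Real.exp (3 / 4 * ℓ) := Real.one_le_exp (by positivity)
      nlinarith
    have := mul_le_mul ha1 hs1 h.s_nonneg zero_le_one
    have := mul_le_mul hq1 hs1 h.s_nonneg zero_le_one
    linarith

end Coord

/-! ### The risk and the conclusion -/

namespace Coord

variable (C : Coord)

/-- The standard deviation `√(sf + α² sp)`. -/
noncomputable def scale (τ : ℝ≥0∞) : ℝ := √((C.sf : ℝ) + C.sp * C.shrink τ ^ 2)

lemma check_integrable (b h m : ℝ) (v : ℝ≥0) :
    Integrable (fun t => b * max t 0 + h * max (-t) 0) (gaussianReal m v) :=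
  ((integrable_id_gaussianReal m v).pos_part.const_mul b).add
    ((integrable_id_gaussianReal m v).neg.pos_part.const_mul h)

/-- `Y` and `X` are independent, so `Y - q̂` is normal with variance `sf + α² sp`, and its mean
divided by its standard deviation is `-(c + d θ)`. The expected check loss is then an explicit
combination of `posMean (±w)`. -/
lemma loss_comp_est (τ : ℝ≥0∞) (θ : ℝ) :
    Integrable (fun x => C.loss θ (C.est τ x)) (gaussianReal θ C.sp) ∧
    ∫ x, C.loss θ (C.est τ x) ∂(gaussianReal θ C.sp) =
      (C.b + C.h) * C.scale τ * G (C.arg τ θ) C.ratio := by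
  have hf := C.sf_real_pos
  have hp := C.sp_real_pos
  have hbh : C.b + C.h ≠ 0 := (add_pos C.b_pos C.h_pos).ne'
  set α := C.shrink τ with hα
  set κ := √((C.sf : ℝ) + α * C.sp) * stdQuantile C.ratio with hκ
  let ψ : ℝ → ℝ := fun t => C.b * max t 0 + C.h * max (-t) 0
  have hψ : Continuous ψ := by fun_prop
  set μ := gaussianReal (-α * θ + -κ) (NNReal.mk ((-α) ^ 2) (sq_nonneg _) * C.sp) with hμ
  have hmap : (gaussianReal θ C.sp).map (fun x => -α * x + -κ) = μ := by
    rw [show (fun x => -α * x + -κ) = (fun x => x + -κ) ∘ fun x => -α * x from rfl,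
      ← Measure.map_map (by fun_prop) (by fun_prop), gaussianReal_map_const_mul,
      gaussianReal_map_add_const]
  have hconv : μ ∗ gaussianReal θ C.sf =
      gaussianReal (θ - α * θ - κ) ((C.sf : ℝ) + C.sp * α ^ 2).toNNReal := by
    rw [hμ, gaussianReal_conv_gaussianReal]
    congr 1
    · ring
    · ext
      rw [Real.coe_toNNReal _ (by positivity)]
      push_cast
      ring
  have hI : Integrable ψ (μ ∗ gaussianReal θ C.sf) := by
    rw [hconv]; exact check_integrable _ _ _ _
  have hloss : ∀ x, C.loss θ (C.est τ x) = ∫ y, ψ ((-α * x + -κ) + y) ∂(gaussianReal θ C.sf) := by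
    intro x
    unfold loss
    congr 1; ext y
    have e1 : y - C.est τ x = (-α * x + -κ) + y := by rw [est]; ring
    have e2 : C.est τ x - y = -((-α * x + -κ) + y) := by rw [est]; ring
    rw [e1, e2]
  have hI2 : Integrable (fun x => ∫ y, ψ (x + y) ∂(gaussianReal θ C.sf)) μ := by
    rw [Measure.conv, integrable_map_measure hψ.aestronglyMeasurable (by fun_prop)] at hI
    exact hI.integral_prod_left
  refine ⟨?_, ?_⟩
  · simp only [hloss]
    rw [← hmap] at hI2
    exact hI2.comp_measurable (by fun_prop)
  · have h1 := integral_conv hI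
    rw [hconv] at h1
    have h2 : ∫ x, C.loss θ (C.est τ x) ∂(gaussianReal θ C.sp) =
        ∫ x, ∫ y, ψ (x + y) ∂(gaussianReal θ C.sf) ∂μ := by
      simp only [hloss]
      rw [← hmap] at hI2 ⊢
      rw [integral_map (by fun_prop) hI2.aestronglyMeasurable]
    rw [h2, ← h1, integral_check_gaussianReal _ _ _ (by positivity)]
    have hs : 0 < √((C.sf : ℝ) + C.sp * α ^ 2) := Real.sqrt_pos.2 (by positivity)
    have harg : (θ - α * θ - κ) / √((C.sf : ℝ) + C.sp * α ^ 2) = -C.arg τ θ := by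
      have h3 := C.shrink_mem τ
      have h4 : C.c τ = κ / √((C.sf : ℝ) + C.sp * α ^ 2) := by
        rw [c, Real.sqrt_div (by have := h3.1; positivity), hκ, ← hα,
          mul_comm (α ^ 2) (C.sp : ℝ)]
        ring
      rw [arg, h4, d, ← hα]
      field_simp
      ring
    rw [harg, neg_neg, G_eq, scale, ← hα, ratio]
    field_simp
    ring

end Coord

instance (M : ℕ → Coord) (θ : ℕ → ℝ) (n : ℕ) : IsProbabilityMeasure (pastLaw M θ n) := by
  unfold pastLaw; infer_instance

lemma integral_pi_eval {n : ℕ} (P : Fin n → Measure ℝ) [∀ i, IsProbabilityMeasure (P i)]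
    (i : Fin n) {f : ℝ → ℝ} (hf : AEStronglyMeasurable f (P i)) :
    ∫ x, f (x i) ∂(Measure.pi P) = ∫ x, f x ∂(P i) :=
  integral_comp_eval (X := fun _ => ℝ) hf

lemma risk_originEst (M : ℕ → Coord) (θ : ℕ → ℝ) (n : ℕ) (τ : ℝ≥0∞) :
    risk M θ n (originEst M n τ) = (1 / n : ℝ) * ∑ i : Fin n,
      ((M i).b + (M i).h) * (M i).scale τ * G ((M i).arg τ (θ i)) (M i).ratio := by
  have hI : ∀ i : Fin n, Integrable (fun x : Fin n → ℝ => (M i).loss (θ i) ((M i).est τ (x i)))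
      (pastLaw M θ n) := fun i =>
    integrable_comp_eval (X := fun _ => ℝ) (μ := fun i : Fin n => gaussianReal (θ i) (M i).sp)
      (i := i) (f := fun x => (M i).loss (θ i) ((M i).est τ x)) ((M i).loss_comp_est τ (θ i)).1
  simp only [risk, avgLoss, originEst]
  rw [integral_const_mul, integral_finsetSum _ fun i _ => hI i]
  congr 1
  refine Finset.sum_congr rfl fun i _ => ?_
  exact (integral_pi_eval (fun i : Fin n => gaussianReal (θ i) (M i).sp) i
    ((M i).loss_comp_est τ (θ i)).1.aestronglyMeasurable).trans ((M i).loss_comp_est τ (θ i)).2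

/-- Second moment of a weighted average of independent variables. -/
lemma lintegral_sq_average_le {n : ℕ} (hn : 0 < n) (P : Fin n → Measure ℝ)
    [∀ i, IsProbabilityMeasure (P i)] {Y : Fin n → ℝ → ℝ} (hY : ∀ i, MemLp (Y i) 2 (P i))
    {k : Fin n → ℝ} {K a b : ℝ} (hk : ∀ i, |k i| ≤ K) (ha : ∀ i, |∫ x, Y i x ∂(P i)| ≤ a)
    (hb : ∀ i, ∫ x, Y i x ^ 2 ∂(P i) ≤ b) :
    ∫⁻ x, ENNReal.ofReal (((1 / n : ℝ) * ∑ i, k i * Y i (x i)) ^ 2) ∂(Measure.pi P) ≤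
      ENNReal.ofReal (K ^ 2 * (b / n + a ^ 2)) := by
  have hn' : (0 : ℝ) < n := by exact_mod_cast hn
  have hK : 0 ≤ K := (abs_nonneg _).trans (hk ⟨0, hn⟩)
  have ha0 : 0 ≤ a := (abs_nonneg _).trans (ha ⟨0, hn⟩)
  let X : Fin n → ℝ → ℝ := fun i x => (k i / n) * Y i x
  have hX : ∀ i, MemLp (X i) 2 (P i) := fun i => (hY i).const_mul _
  have hX2 : ∀ i, MemLp (fun x : Fin n → ℝ => X i (x i)) 2 (Measure.pi P) := fun i =>
    (hX i).comp_measurePreserving (measurePreserving_eval P i)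
  let D : (Fin n → ℝ) → ℝ := ∑ i, fun x : Fin n → ℝ => X i (x i)
  have hD : ∀ x, D x = (1 / n : ℝ) * ∑ i, k i * Y i (x i) := fun x => by
    simp only [D, X, Finset.sum_apply, Finset.mul_sum]
    exact Finset.sum_congr rfl fun i _ => by ring
  have hD2 : MemLp D 2 (Measure.pi P) := by
    have h1 := memLp_finsetSum Finset.univ fun i _ => hX2 i
    have h2 : D = fun x => ∑ i, X i (x i) := by ext x; simp [D]
    rwa [h2]
  simp only [← hD]
  rw [← ofReal_integral_eq_lintegral_ofReal hD2.integrable_sq (ae_of_all _ fun x => sq_nonneg _)]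
  refine ENNReal.ofReal_le_ofReal ?_
  have hvar : Var[D; Measure.pi P] = ∑ i, Var[X i; P i] := variance_sum_pi hX
  have hsub := variance_eq_sub hD2
  simp only [Pi.pow_apply] at hsub
  have hv : ∀ i, Var[X i; P i] ≤ (K / n) ^ 2 * b := fun i => by
    have h1 : Var[X i; P i] = (k i / n) ^ 2 * Var[Y i; P i] := variance_const_mul _ _ _
    have h2 : Var[Y i; P i] ≤ b :=
      (variance_le_expectation_sq (hY i).aestronglyMeasurable).trans (hb i)
    have h3 : (k i / n) ^ 2 ≤ (K / n) ^ 2 := by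
      rw [div_pow, div_pow, ← sq_abs (k i)]
      have := hk i
      gcongr
    rw [h1]
    exact mul_le_mul h3 h2 (variance_nonneg _ _) (sq_nonneg _)
  have hmean : |∫ x, D x ∂(Measure.pi P)| ≤ K * a := by
    have h1 : ∫ x, D x ∂(Measure.pi P) = ∑ i, (k i / n) * ∫ x, Y i x ∂(P i) := by
      simp only [D, Finset.sum_apply]
      rw [integral_finsetSum _ fun i _ => (hX2 i).integrable one_le_two]
      refine Finset.sum_congr rfl fun i _ => ?_
      rw [integral_pi_eval P i (hX i).aestronglyMeasurable, integral_const_mul]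
    rw [h1]
    refine (Finset.abs_sum_le_sum_abs _ _).trans ?_
    calc _ ≤ ∑ i : Fin n, K / n * a := by
          refine Finset.sum_le_sum fun i _ => ?_
          rw [abs_mul, abs_div, abs_of_pos hn']
          have := hk i
          have := ha i
          gcongr
      _ = K * a := by simp; field_simp
  -- Variance plus squared mean; independence makes the variance additive, hence the gain of `1/n`
  -- on `b` only.
  calc ∫ x, D x ^ 2 ∂(Measure.pi P) = ∑ i, Var[X i; P i] + (∫ x, D x ∂(Measure.pi P)) ^ 2 := by
        linarith
    _ ≤ ∑ i : Fin n, (K / n) ^ 2 * b + (K * a) ^ 2 := by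
        rw [← sq_abs (∫ x, D x ∂(Measure.pi P))]
        gcongr with i
        exact hv i
    _ = _ := by simp; field_simp

lemma ARE_sub_risk (M : ℕ → Coord) (γ θ : ℕ → ℝ) (n : ℕ) (τ : ℝ≥0∞) (x : Fin n → ℝ) :
    ARE M γ n τ x - risk M θ n (originEst M n τ) = (1 / n : ℝ) * ∑ i : Fin n,
      ((M i).b + (M i).h) * (M i).scale τ *
        ((M i).T (γ i) n τ (x i) - G ((M i).arg τ (θ i)) (M i).ratio) := by
  rw [risk_originEst, ARE, ← mul_sub, ← Finset.sum_sub_distrib]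
  congr 1
  exact Finset.sum_congr rfl fun i _ => by rw [Coord.scale]; ring

lemma tendsto_loglog_pow_mul {C δ : ℝ} (hδ : 0 < δ) :
    Tendsto (fun n : ℕ => Real.log (Real.log n) ^ 8 *
      (C * ((1 + Real.log n) ^ 4 * Real.exp (-(δ * Real.log n))))) atTop (𝓝 0) := by
  have hlog : Tendsto (fun n : ℕ => Real.log n) atTop atTop :=
    Real.tendsto_log_atTop.comp tendsto_natCast_atTop_atTop
  have key : Tendsto (fun t : ℝ => Real.log t ^ 8 * (C * ((1 + t) ^ 4 * Real.exp (-(δ * t)))))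
      atTop (𝓝 0) := by
    -- For `t ≥ 1`, `log t ≤ t` and `1 + t ≤ 2t` bound the polynomial factor by `16 t^12`.
    have h0 := (tendsto_rpow_mul_exp_neg_mul_atTop_nhds_zero 12 δ hδ).const_mul (|C| * 16)
    rw [mul_zero] at h0
    refine squeeze_zero_norm' ?_ h0
    filter_upwards [eventually_ge_atTop 1] with t ht
    have h1 : 0 ≤ Real.log t := Real.log_nonneg ht
    have h2 : Real.log t ≤ t := (Real.log_le_sub_one_of_pos (by linarith)).trans (by linarith)
    rw [norm_mul, norm_mul, Real.norm_of_nonneg (by positivity : 0 ≤ Real.log t ^ 8),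
      Real.norm_of_nonneg (by positivity : 0 ≤ (1 + t) ^ 4 * Real.exp (-(δ * t))),
      Real.norm_eq_abs]
    calc _ ≤ t ^ 8 * (|C| * ((2 * t) ^ 4 * Real.exp (-(δ * t)))) := by gcongr; linarith
      _ = |C| * 16 * (t ^ (12 : ℕ) * Real.exp (-δ * t)) := by rw [neg_mul]; ring
      _ = _ := by rw [← Real.rpow_natCast t 12]; norm_num
  exact key.comp hlog

end CheckLoss

open CheckLoss in
theorem mainTheorem1 (M : ℕ → Coord) (γ θ : ℕ → ℝ)
    (hA1 : BoundedWeights M) (hA2 : BoundedMeans θ) (hA3 : SufficientData M)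
    (hγ : AdmissibleThresholds M γ) :
    Tendsto (fun n : ℕ => ENNReal.ofReal (Real.log (Real.log n) ^ 8) *
        ⨆ τ : ℝ≥0∞, ∫⁻ x, ENNReal.ofReal ((ARE M γ n τ x - risk M θ n (originEst M n τ)) ^ 2)
          ∂(pastLaw M θ n))
      atTop (𝓝 0) := by
  obtain ⟨-, -, B, hB⟩ := hA1
  obtain ⟨⟨r, hr, hρ⟩, ⟨F, hF⟩, -⟩ := hA3
  obtain ⟨⟨l, hl, hlγ⟩, hγρ⟩ := hγ
  have hρ' : ∀ i, ((M i).sp / (M i).sf : ℝ) ≤ 1 / (4 * Real.exp 1) := fun i => (hρ i).trans hr.le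
  -- One exponent for all coordinates: the `γ i` are bounded below by `l`, hence `δ ≤ (γ i)²/4` for
  -- every `i`.
  obtain ⟨δ, hδ0, hδ4, hδl⟩ : ∃ δ : ℝ, 0 < δ ∧ δ ≤ 1 / 4 ∧ δ ≤ l ^ 2 / 4 :=
    ⟨min (1 / 4) (l ^ 2 / 4), lt_min (by norm_num) (by positivity), min_le_left _ _,
      min_le_right _ _⟩
  -- Since `sp ≤ sf` and `α ≤ 1`, the variance `sf + α² sp` is at most `2 sf`.
  set K := B * √(2 * F)
  have hK : ∀ i τ, |((M i).b + (M i).h) * (M i).scale τ| ≤ K := fun i τ => by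
    have hb := add_pos (M i).b_pos (M i).h_pos
    have hsf := (M i).sf_real_pos
    have hsp := (M i).sp_real_pos
    obtain ⟨s0, s1⟩ := (M i).shrink_mem τ
    rw [Coord.scale, abs_of_nonneg (mul_nonneg hb.le (Real.sqrt_nonneg _))]
    have h1 : ((M i).sp : ℝ) ≤ (M i).sf := by
      have h2 : 1 / (4 * Real.exp 1) ≤ 1 := by
        rw [div_le_one (by positivity)]; linarith [Real.exp_one_gt_d9]
      have := (hρ' i).trans h2
      rwa [div_le_one hsf] at this
    have h3 : ((M i).sp : ℝ) * (M i).shrink τ ^ 2 ≤ (M i).sp :=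
      mul_le_of_le_one_right hsp.le (by nlinarith)
    exact mul_le_mul (hB i) (Real.sqrt_le_sqrt (by linarith [hF i])) (Real.sqrt_nonneg _)
      (hb.le.trans (hB i))
  have key : ∀ n : ℕ, 1 ≤ n → ∀ τ : ℝ≥0∞,
      ∫⁻ x, ENNReal.ofReal ((ARE M γ n τ x - risk M θ n (originEst M n τ)) ^ 2) ∂(pastLaw M θ n) ≤
        ENNReal.ofReal (K ^ 2 * 1000 * ((1 + Real.log n) ^ 4 * Real.exp (-(δ * Real.log n)))) := by
    intro n hn τ
    have hT := fun i : Fin n => (M i).T_bounds (hρ' i) (hl.trans_le (hlγ i)) (hγρ i).le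
      hδ4 (hδl.trans (by have := hlγ i; gcongr)) hn τ (θ i)
    have hn' : (0 : ℝ) < n := by exact_mod_cast hn
    simp only [ARE_sub_risk]
    refine (lintegral_sq_average_le hn (fun i : Fin n => gaussianReal (θ i) (M i).sp)
      (fun i => (hT i).1) (fun i => hK i τ) (fun i => (hT i).2.1) (fun i => (hT i).2.2)).trans ?_
    refine ENNReal.ofReal_le_ofReal ?_
    set ℓ := Real.log n with hℓdef
    have hℓ : 0 ≤ ℓ := Real.log_nonneg (by exact_mod_cast hn)
    have hexp : Real.exp ℓ = n := Real.exp_log hn'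
    rw [mul_assoc (K ^ 2)]
    refine mul_le_mul_of_nonneg_left ?_ (sq_nonneg K)
    -- Averaging turns `n^(3/4)` into `n^(-1/4)`, at most `n^(-δ)`; this uses `δ ≤ 1/4`.
    have h1 : 64 * (1 + ℓ) ^ 2 * Real.exp (3 / 4 * ℓ) / n ≤
        64 * ((1 + ℓ) ^ 4 * Real.exp (-(δ * ℓ))) := by
      rw [← hexp, mul_div_assoc, ← Real.exp_sub, mul_assoc]
      gcongr
      · linarith
      · norm_num
      · nlinarith
    have h2 : (30 * (1 + ℓ) ^ 2 * Real.exp (-(δ * ℓ))) ^ 2 ≤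
        900 * ((1 + ℓ) ^ 4 * Real.exp (-(δ * ℓ))) := by
      have h3 : Real.exp (-(δ * ℓ)) ^ 2 ≤ Real.exp (-(δ * ℓ)) := by
        have h4 : Real.exp (-(δ * ℓ)) ≤ 1 := Real.exp_le_one_iff.2 (by nlinarith)
        nlinarith [Real.exp_pos (-(δ * ℓ))]
      calc _ = 900 * ((1 + ℓ) ^ 4 * Real.exp (-(δ * ℓ)) ^ 2) := by ring
        _ ≤ _ := by gcongr
    have h5 : 0 ≤ (1 + ℓ) ^ 4 * Real.exp (-(δ * ℓ)) := by positivity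
    linarith
  have hlim := ENNReal.tendsto_ofReal (tendsto_loglog_pow_mul (C := K ^ 2 * 1000) hδ0)
  rw [ENNReal.ofReal_zero] at hlim
  refine tendsto_of_tendsto_of_tendsto_of_le_of_le' tendsto_const_nhds hlim
    (Eventually.of_forall fun n => zero_le) ?_
  filter_upwards [eventually_ge_atTop 1] with n hn
  rw [ENNReal.ofReal_mul (by positivity)]
  gcongr
  exact iSup_le (key n hn)
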